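/- Let $D\ge 1$ and $\ell\ge 2$ be integers. For $n\ge 0$ let $\mathcal F_n$ be the family of the $\ell$-adic cubes $\prod_{i=1}^D[k_i\ell^{-n},(k_i+1)\ell^{-n})$, $0\le k_i<\ell^n$, of $[0,1)^D$. Suppose that for every $n$ the cubes of $\mathcal F_n$ are coded bijectively as $I_{\varepsilon_1\cdots\varepsilon_n}$ by the words $\varepsilon_1\cdots\varepsilon_n$ with letters in $\{0,\dots,\ell^D-1\}$, in such a way that $I_{\varepsilon_1\cdots\varepsilon_{n+1}}\subset I_{\varepsilon_1\cdots\varepsilon_n}$; for cubes $I,J\in\bigcup_n\mathcal F_n$ let $IJ$ be the cube whose word is the concatenation of those of $I$ and $J$. Let $m$ be a quasi-Bernoulli measure on $[0,1)^D$, that is, a Borel probability measure for which there is a constant $C\ge 1$ with $$\frac1C\,m(I)\,m(J)\le m(IJ)\le C\,m(I)\,m(J)\qquad\text{for all } I,J\in\bigcup_n\mathcal F_n .$$ Let $$\tau(q)=\limsup_{n\to\infty}\frac1{n\log\ell}\log\Bigl(\sum_{I\in\mathcal F_n,\ m(I)>0}m(I)^q\Bigr)$$ be its $L^q$-spectrum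 and $d=-\tau'(1)$. Suppose that there is a real $\sigma>0$ such that $$\tau(1-q)=qd+\frac{\sigma^2}2q^2+o(q^2)\qquad (q\to0).$$ For $a\in\mathbb R$ let $\psi_a(t)=t^d\,\ell^{\,a\sqrt{\log_\ell(1/t)}}$ for small $t>0$ and $\psi_a(0)=0$. Let $\mathcal H^{\psi}$ be the Hausdorff measure on $\mathbb R^D$ with gauge $\psi$, and let $\widehat{\mathcal P}^{\psi}$ be the packing measure with gauge $\psi$, namely $\widehat{\mathcal P}^{\psi}(E)=\inf\{\sum_i\mathcal P^\psi(E_i) : E\subset\bigcup_{i\in\mathbb N} E_i\}$, where $\mathcal P^\psi(E)$ is the limit as $\delta\to0^+$ of the supremum of $\sum_j\psi(2r_j)$ over the countable families of pairwise disjoint closed balls $B(x_j,r_j)$ with $x_j\in E$ and $0<r_j\le\delta$. Then $$m\perp\mathcal H^{\psi_a}\ \text{ for every } a>0,\qquad\text{and}\qquad m\ll\widehat{\mathcal P}^{\psi_a}\ \text{ for every } a<0 .$$ -/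

import Mathlib

open MeasureTheory Filter Topology
open scoped ENNReal Asymptotics

noncomputable section

namespace QuasiBernoulli

/-! ### Generalized Hausdorff and packing measures -/

section GaugeMeasures

variable {X : Type*} [MetricSpace X]

/-- The Hausdorff measure `H^ψ` with gauge function `ψ`: the limit as `δ → 0` of the infimum of
`∑ ψ (diam Uᵢ)` over the countable covers by sets of diameter at most `δ`. -/
def hausdorffGauge [MeasurableSpace X] [BorelSpace X] (ψ : ℝ → ℝ) : Measure X :=
  Measure.mkMetric fun t => ENNReal.ofReal (ψ t.toReal)

/-- A `δ`-packing of `E`: a countable family of pairwise disjoint closed balls, given by their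
centres and radii, with centres in `E` and radii in `(0, δ]`. -/
structure IsPacking (δ : ℝ) (E : Set X) (p : Set (X × ℝ)) : Prop where
  countable : p.Countable
  center_mem : ∀ b ∈ p, b.1 ∈ E
  radius_pos : ∀ b ∈ p, 0 < b.2
  radius_le : ∀ b ∈ p, b.2 ≤ δ
  disjoint : p.PairwiseDisjoint fun b => Metric.closedBall b.1 b.2

/-- The supremum of `∑ ψ (2 rᵢ)` over the `δ`-packings of `E`. -/
def packingAt (ψ : ℝ → ℝ) (δ : ℝ) (E : Set X) : ℝ≥0∞ :=
  ⨆ (p : Set (X × ℝ)) (_ : IsPacking δ E p), ∑' b : p, ENNReal.ofReal (ψ (2 * b.1.2))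

/-- The packing pre-measure `P^ψ`, the limit of `packingAt ψ δ` as `δ` decreases to `0`. -/
def packingPre (ψ : ℝ → ℝ) (E : Set X) : ℝ≥0∞ :=
  ⨅ (δ : ℝ) (_ : 0 < δ), packingAt ψ δ E

theorem packingAt_empty (ψ : ℝ → ℝ) (δ : ℝ) : packingAt ψ δ (∅ : Set X) = 0 := by
  simp only [packingAt, ENNReal.iSup_eq_zero]
  intro p hp
  have : p = ∅ := Set.eq_empty_of_forall_notMem fun b hb => hp.center_mem b hb
  subst this
  simp

theorem packingPre_empty (ψ : ℝ → ℝ) : packingPre ψ (∅ : Set X) = 0 :=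
  le_antisymm ((iInf₂_le 1 one_pos).trans (packingAt_empty ψ 1).le) bot_le

theorem packingAt_mono (ψ : ℝ → ℝ) {δ δ' : ℝ} (hδ : δ ≤ δ') {E F : Set X} (h : E ⊆ F) :
    packingAt ψ δ E ≤ packingAt ψ δ' F :=
  iSup_mono fun p => iSup_mono' fun hp =>
    ⟨⟨hp.countable, fun b hb => h (hp.center_mem b hb), hp.radius_pos,
      fun b hb => (hp.radius_le b hb).trans hδ, hp.disjoint⟩, le_rfl⟩

theorem packingPre_mono (ψ : ℝ → ℝ) {E F : Set X} (h : E ⊆ F) :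
    packingPre ψ E ≤ packingPre ψ F :=
  iInf₂_mono fun _ _ => packingAt_mono ψ le_rfl h

theorem packingAt_add_le (ψ : ℝ → ℝ) {δ : ℝ} {E F : Set X}
    (h : ∀ x ∈ E, ∀ y ∈ F, 2 * δ < dist x y) :
    packingAt ψ δ E + packingAt ψ δ F ≤ packingAt ψ δ (E ∪ F) := by
  have hdisj : ∀ b c : X × ℝ, b.1 ∈ E → c.1 ∈ F → b.2 ≤ δ → c.2 ≤ δ →
      Disjoint (Metric.closedBall b.1 b.2) (Metric.closedBall c.1 c.2) := by
    intro b c hb hc hbδ hcδ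
    exact Metric.closedBall_disjoint_closedBall (by linarith [h _ hb _ hc])
  unfold packingAt
  refine ENNReal.biSup_add_biSup_le' (p := fun p => IsPacking δ E p)
    (q := fun p => IsPacking δ F p) ⟨∅, by constructor <;> simp⟩ ⟨∅, by constructor <;> simp⟩ ?_
  intro p hp q hq
  have hpq : Disjoint p q := by
    rw [Set.disjoint_left]
    intro b hb hb'
    have := h _ (hp.center_mem b hb) _ (hq.center_mem b hb')
    rw [dist_self] at this
    linarith [hp.radius_pos b hb, hp.radius_le b hb]
  rw [← ENNReal.summable.tsum_union_disjoint (f := fun b : X × ℝ => ENNReal.ofReal (ψ (2 * b.2)))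
    hpq ENNReal.summable]
  refine le_iSup₂_of_le (p ∪ q) ⟨hp.countable.union hq.countable, ?_, ?_, ?_, ?_⟩ le_rfl
  · rintro b (hb | hb)
    · exact Or.inl (hp.center_mem b hb)
    · exact Or.inr (hq.center_mem b hb)
  · rintro b (hb | hb)
    · exact hp.radius_pos b hb
    · exact hq.radius_pos b hb
  · rintro b (hb | hb)
    · exact hp.radius_le b hb
    · exact hq.radius_le b hb
  · rintro b (hb | hb) c (hc | hc) hbc
    · exact hp.disjoint hb hc hbc
    · exact hdisj b c (hp.center_mem b hb) (hq.center_mem c hc) (hp.radius_le b hb)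
        (hq.radius_le c hc)
    · exact (hdisj c b (hp.center_mem c hc) (hq.center_mem b hb) (hp.radius_le c hc)
        (hq.radius_le b hb)).symm
    · exact hq.disjoint hb hc hbc

theorem packingPre_add_le (ψ : ℝ → ℝ) {E F : Set X} (h : Metric.AreSeparated E F) :
    packingPre ψ E + packingPre ψ F ≤ packingPre ψ (E ∪ F) := by
  obtain ⟨r, hr0, hr⟩ := h
  obtain ⟨s, hs0, hsr⟩ : ∃ s : ℝ, 0 < s ∧ ENNReal.ofReal s ≤ r := by
    rcases eq_or_ne r ⊤ with rfl | hr'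
    · exact ⟨1, one_pos, le_top⟩
    · exact ⟨r.toReal, ENNReal.toReal_pos hr0 hr', ENNReal.ofReal_toReal_le⟩
  refine le_iInf₂ fun δ hδ => ?_
  have hpos : 0 < min δ (s / 3) := lt_min hδ (by positivity)
  refine le_trans (add_le_add (iInf₂_le _ hpos) (iInf₂_le _ hpos)) ?_
  refine (packingAt_add_le ψ fun x hx y hy => ?_).trans
    (packingAt_mono ψ (min_le_left _ _) subset_rfl)
  have h1 : s ≤ dist x y := by
    have := hsr.trans (hr x hx y hy)
    rwa [edist_dist, ENNReal.ofReal_le_ofReal_iff dist_nonneg] at this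
  linarith [min_le_right δ (s / 3)]

/-- The packing measure as an outer measure: the infimum of `∑ P^ψ (Eᵢ)` over the countable
covers of a set by arbitrary sets `Eᵢ`. -/
def packingOuter (X : Type*) [MetricSpace X] (ψ : ℝ → ℝ) : OuterMeasure X :=
  OuterMeasure.ofFunction (packingPre ψ) (packingPre_empty ψ)

theorem packingOuter_isMetric (ψ : ℝ → ℝ) : (packingOuter X ψ).IsMetric := by
  intro s t hst
  refine le_antisymm (measure_union_le s t) ?_
  conv_rhs => rw [packingOuter, OuterMeasure.ofFunction_apply]
  refine le_iInf₂ fun U hU => ?_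
  have hs : packingOuter X ψ s ≤ ∑' i, packingPre ψ (U i ∩ s) := by
    rw [packingOuter, OuterMeasure.ofFunction_apply]
    refine iInf₂_le_of_le (fun i => U i ∩ s) ?_ le_rfl
    rw [← Set.iUnion_inter]
    exact Set.subset_inter (Set.subset_union_left.trans hU) subset_rfl
  have ht : packingOuter X ψ t ≤ ∑' i, packingPre ψ (U i ∩ t) := by
    rw [packingOuter, OuterMeasure.ofFunction_apply]
    refine iInf₂_le_of_le (fun i => U i ∩ t) ?_ le_rfl
    rw [← Set.iUnion_inter]
    exact Set.subset_inter (Set.subset_union_right.trans hU) subset_rfl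
  refine (add_le_add hs ht).trans ?_
  rw [← ENNReal.tsum_add]
  refine ENNReal.tsum_le_tsum fun i => ?_
  refine (packingPre_add_le ψ
    (hst.mono Set.inter_subset_right Set.inter_subset_right)).trans (packingPre_mono ψ ?_)
  exact Set.union_subset Set.inter_subset_left Set.inter_subset_left

/-- The packing measure with gauge function `ψ`, as a Borel measure. -/
def packingGauge [MeasurableSpace X] [BorelSpace X] (ψ : ℝ → ℝ) : Measure X :=
  (packingOuter X ψ).toMeasure <| by
    rw [BorelSpace.measurable_eq (α := X)]
    exact (packingOuter_isMetric ψ).borel_le_caratheodory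

end GaugeMeasures

/-! ### Quasi-Bernoulli measures on the unit cube -/

/-- The half-open `ℓ`-adic cube `∏ᵢ [kᵢ / ℓ ^ n, (kᵢ + 1) / ℓ ^ n)`. -/
def adicCube (D ℓ n : ℕ) (k : Fin D → Fin (ℓ ^ n)) : Set (EuclideanSpace ℝ (Fin D)) :=
  {x | ∀ i, x i ∈ Set.Ico (((k i : ℕ) : ℝ) / (ℓ : ℝ) ^ n) ((((k i : ℕ) : ℝ) + 1) / (ℓ : ℝ) ^ n)}

/-- The family `F_n` of the `ℓ`-adic cubes of the `n`-th generation of `[0,1)^D`. -/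
def adicCubes (D ℓ n : ℕ) : Set (Set (EuclideanSpace ℝ (Fin D))) :=
  Set.range (adicCube D ℓ n)

/-- A coding of the `ℓ`-adic cubes by words in `ℓ ^ D` letters: for each `n` the words of length
`n` correspond bijectively to the cubes of generation `n`, and appending a letter passes to a
smaller cube. -/
structure IsCoding (D ℓ : ℕ) (I : List (Fin (ℓ ^ D)) → Set (EuclideanSpace ℝ (Fin D))) :
    Prop where
  bijOn : ∀ n : ℕ, Set.BijOn I {w | w.length = n} (adicCubes D ℓ n)
  nested : ∀ (w : List (Fin (ℓ ^ D))) (e : Fin (ℓ ^ D)), I (w ++ [e]) ⊆ I w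

/-- `m` is a quasi-Bernoulli probability measure on `[0,1)^D` for the coding `I`. -/
structure IsQuasiBernoulli {D ℓ : ℕ} (I : List (Fin (ℓ ^ D)) → Set (EuclideanSpace ℝ (Fin D)))
    (m : Measure (EuclideanSpace ℝ (Fin D))) : Prop where
  isProbabilityMeasure : IsProbabilityMeasure m
  measure_unitCube : m {x | ∀ i, x i ∈ Set.Ico (0 : ℝ) 1} = 1
  quasi : ∃ C : ℝ, 1 ≤ C ∧ ∀ u v : List (Fin (ℓ ^ D)),
    1 / C * (m.real (I u) * m.real (I v)) ≤ m.real (I (u ++ v)) ∧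
      m.real (I (u ++ v)) ≤ C * (m.real (I u) * m.real (I v))

/-- `τ_n(q) = (1 / (n log ℓ)) log ∑ m(I) ^ q`, the sum being over the cubes `I` of generation `n`
with positive measure. -/
def tauAt {D : ℕ} (ℓ : ℕ) (m : Measure (EuclideanSpace ℝ (Fin D))) (n : ℕ) (q : ℝ) : ℝ :=
  1 / (n * Real.log ℓ) *
    Real.log (∑ k : Fin D → Fin (ℓ ^ n) with 0 < m.real (adicCube D ℓ n k),
      m.real (adicCube D ℓ n k) ^ q)

/-- The `L^q`-spectrum `τ` of `m`. -/
def tau {D : ℕ} (ℓ : ℕ) (m : Measure (EuclideanSpace ℝ (Fin D))) (q : ℝ) : ℝ :=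
  limsup (fun n => tauAt ℓ m n q) atTop

/-- The gauge `ψ_a(t) = t ^ d ℓ ^ (a √(log_ℓ (1 / t)))`, of interest for small `t > 0`. -/
def psi (ℓ : ℕ) (d a t : ℝ) : ℝ :=
  t ^ d * (ℓ : ℝ) ^ (a * √(Real.logb ℓ (1 / t)))

end QuasiBernoulli

end

/-!
Almost multiplicativity makes `log ∑ m(I) ^ q`, the sum being over the cubes of generation `n`,
equal to `n (log ℓ) τ(q)` up to an error that is bounded in `n`. Hence, under `m`, the deviation
`(log m(Iₙ(x)) + n d log ℓ) / √n` of the cube `Iₙ(x)` of generation `n` around `x` has, for every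
`t`, a Laplace transform at `t` comparable with the Gaussian one `exp (v t² / 2)`, where
`v = σ² log ℓ`. The Paley-Zygmund inequality then bounds from below the probability that the
deviation exceeds a given `A`, and the probability that it lies below `-A`. The quasi-Bernoulli
property carries these bounds into every cube, so that almost every point lies in infinitely many
cubes of each kind.

The heavy cubes, of mass at least `ℓ ^ (-n d) exp (A √n)`, form a cover for which the sum of the
gauges is finite, which gives a set of full measure that is null for the Hausdorff measure. For the
packing measure one uses the light cubes and the Vitali covering lemma, after replacing balls by
cubes: by the Borel-Cantelli lemma the ball of radius `ℓ ^ (-n)` around almost every `x` eventually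
has at most `n ^ 2` times the mass of `Iₙ(x)`, and this factor is negligible against `exp √n`.
-/

noncomputable section

namespace QuasiBernoulli

/-! ### Almost additive sequences -/

/-- A real sequence that is additive up to an error of at most `κ`. -/
def AlmostAdditive (a : ℕ → ℝ) (κ : ℝ) : Prop :=
  ∀ n p, |a (n + p) - (a n + a p)| ≤ κ

namespace AlmostAdditive

variable {a : ℕ → ℝ} {κ : ℝ}

theorem neg (h : AlmostAdditive a κ) : AlmostAdditive (-a) κ := fun n p => by
  rw [← abs_neg]
  convert h n p using 2
  simp only [Pi.neg_apply]
  ring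

theorem subadditive_add_const (h : AlmostAdditive a κ) : Subadditive fun n => a n + κ :=
  fun n p => by linarith [(abs_le.1 (h n p)).2]

theorem bddBelow_range_div (h : AlmostAdditive a κ) :
    BddBelow (Set.range fun n : ℕ => (a n + κ) / n) := by
  refine ⟨min 0 (a 1 - κ), ?_⟩
  rintro _ ⟨n, rfl⟩
  obtain rfl | hn := n.eq_zero_or_pos
  · simp
  have hn_pos : (0 : ℝ) < n := Nat.cast_pos.2 hn
  have h_linear : n * (a 1 - κ) ≤ a n + κ := by
    have h_iter := h.neg.subadditive_add_const.apply_mul_add_le n 1 0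
    have h_zero := (abs_le.1 (h 0 0)).2
    simp only [mul_one, add_zero, Pi.neg_apply] at h_iter h_zero
    linarith
  exact (min_le_right _ _).trans ((le_div_iff₀' hn_pos).2 h_linear)

theorem tendsto_div (h : AlmostAdditive a κ) :
    Tendsto (fun n => a n / n) atTop (𝓝 h.subadditive_add_const.lim) := by
  have h_fekete := h.subadditive_add_const.tendsto_lim h.bddBelow_range_div
  simpa [add_div] using h_fekete.sub (tendsto_const_div_atTop_nhds_zero_nat κ)

theorem mul_lim_le (h : AlmostAdditive a κ) {L : ℝ}
    (hL : Tendsto (fun n => a n / n) atTop (𝓝 L)) (n : ℕ) : n * L ≤ a n + κ := by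
  obtain rfl | hn := n.eq_zero_or_pos
  · have h_zero := (abs_le.1 (h 0 0)).2
    simp only [add_zero, Nat.cast_zero, zero_mul] at h_zero ⊢
    linarith
  rw [tendsto_nhds_unique hL h.tendsto_div, ← le_div_iff₀' (Nat.cast_pos.2 hn)]
  exact h.subadditive_add_const.lim_le_div h.bddBelow_range_div hn.ne'

theorem abs_sub_mul_lim_le (h : AlmostAdditive a κ) {L : ℝ}
    (hL : Tendsto (fun n => a n / n) atTop (𝓝 L)) (n : ℕ) : |a n - n * L| ≤ κ := by
  have h_lower := h.mul_lim_le hL n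
  have h_upper := h.neg.mul_lim_le (L := -L) (by simpa only [Pi.neg_apply, neg_div] using hL.neg) n
  rw [Pi.neg_apply, mul_neg] at h_upper
  exact abs_le.2 ⟨by linarith, by linarith⟩

end AlmostAdditive

/-! ### Quasi-multiplicative weights on words -/

section LogSum

variable {ι : Type*} {s : Finset ι} {f g : ι → ℝ} {K : ℝ}

theorem log_sum_le_log_sum_add (hs : s.Nonempty) (hf : ∀ i ∈ s, 0 < f i) (hg : ∀ i ∈ s, 0 < g i)
    (h : ∀ i ∈ s, Real.log (f i) ≤ Real.log (g i) + K) :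
    Real.log (∑ i ∈ s, f i) ≤ Real.log (∑ i ∈ s, g i) + K := by
  have hg_sum : 0 < ∑ i ∈ s, g i := Finset.sum_pos hg hs
  rw [Real.log_le_iff_le_exp (Finset.sum_pos hf hs), Real.exp_add, Real.exp_log hg_sum,
    Finset.sum_mul]
  refine Finset.sum_le_sum fun i hi => ?_
  rw [← Real.exp_log (hg i hi), ← Real.exp_add, ← Real.log_le_iff_le_exp (hf i hi)]
  exact h i hi

theorem abs_log_sum_sub_log_sum_le (hs : s.Nonempty) (hf : ∀ i ∈ s, 0 < f i)
    (hg : ∀ i ∈ s, 0 < g i) (h : ∀ i ∈ s, |Real.log (f i) - Real.log (g i)| ≤ K) :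
    |Real.log (∑ i ∈ s, f i) - Real.log (∑ i ∈ s, g i)| ≤ K := by
  have h_upper := log_sum_le_log_sum_add (K := K) hs hf hg fun i hi => by
    linarith [(abs_le.1 (h i hi)).2]
  have h_lower := log_sum_le_log_sum_add (K := K) hs hg hf fun i hi => by
    linarith [(abs_le.1 (h i hi)).1]
  exact abs_le.2 ⟨by linarith, by linarith⟩

end LogSum

section Words

/-- The words of length `n` over a finite alphabet. -/
def words (α : Type*) [Finite α] (n : ℕ) : Finset (List α) :=
  (List.finite_length_eq α n).toFinset

variable {α : Type*} [Finite α]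

@[simp] theorem mem_words {n : ℕ} {w : List α} : w ∈ words α n ↔ w.length = n := by
  simp [words]

theorem sum_words_add (f : List α → ℝ) (n p : ℕ) :
    ∑ w ∈ words α (n + p), f w = ∑ x ∈ words α n ×ˢ words α p, f (x.1 ++ x.2) := by
  refine Finset.sum_nbij' (fun w => (w.take n, w.drop n)) (fun x => x.1 ++ x.2) ?_ ?_ ?_ ?_ ?_
  · intro w hw
    simp_all
  · rintro ⟨u, v⟩ huv
    simp_all
  · intro w _
    exact w.take_append_drop n
  · rintro ⟨u, v⟩ huv
    obtain ⟨rfl, -⟩ : u.length = n ∧ v.length = p := by simpa using huv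
    simp
  · intro w _
    rw [w.take_append_drop n]

theorem tsum_eq_tsum_sum_words (f : List α → ℝ≥0∞) :
    ∑' w, f w = ∑' n, ∑ w ∈ words α n, f w := by
  rw [← ENNReal.tsum_fiberwise f List.length]
  refine tsum_congr fun n => ?_
  have h_fiber : List.length ⁻¹' {n} = (words α n : Set (List α)) := by
    ext w
    simp
  rw [h_fiber, Finset.tsum_subtype']

/-- A weight on words that has total mass one in each length and is multiplicative up to the
factor `C`. -/
structure IsQuasiMultiplicative (μ : List α → ℝ) (C : ℝ) : Prop where
  one_le : 1 ≤ C
  nonneg : ∀ w, 0 ≤ μ w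
  sum_eq_one : ∀ n, ∑ w ∈ words α n, μ w = 1
  lower : ∀ u v, 1 / C * (μ u * μ v) ≤ μ (u ++ v)
  upper : ∀ u v, μ (u ++ v) ≤ C * (μ u * μ v)

/-- The words of length `n` with positive weight. -/
def positiveWords (μ : List α → ℝ) (n : ℕ) : Finset (List α) :=
  {w ∈ words α n | 0 < μ w}

theorem mem_positiveWords {μ : List α → ℝ} {n : ℕ} {w : List α} :
    w ∈ positiveWords μ n ↔ w.length = n ∧ 0 < μ w := by
  simp [positiveWords]

/-- The sum of the `q`-th powers of the positive weights of the words of length `n`. -/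
def partitionSum (μ : List α → ℝ) (n : ℕ) (q : ℝ) : ℝ :=
  ∑ w ∈ positiveWords μ n, μ w ^ q

/-- The exponential growth rate in `n` of `partitionSum μ n q`. -/
def pressure (μ : List α → ℝ) (q : ℝ) : ℝ :=
  limsup (fun n : ℕ => Real.log (partitionSum μ n q) / n) atTop

namespace IsQuasiMultiplicative

variable {μ : List α → ℝ} {C : ℝ}

theorem sum_positiveWords (h : IsQuasiMultiplicative μ C) (n : ℕ) :
    ∑ w ∈ positiveWords μ n, μ w = 1 := by
  rw [← h.sum_eq_one n, positiveWords]
  exact Finset.sum_filter_of_ne fun w _ hw => (h.nonneg w).lt_of_ne' hw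

theorem positiveWords_nonempty (h : IsQuasiMultiplicative μ C) (n : ℕ) :
    (positiveWords μ n).Nonempty :=
  Finset.nonempty_of_sum_ne_zero ((h.sum_positiveWords n).trans_ne one_ne_zero)

theorem append_pos_iff (h : IsQuasiMultiplicative μ C) {u v : List α} :
    0 < μ (u ++ v) ↔ 0 < μ u ∧ 0 < μ v := by
  have hC : 0 < C := one_pos.trans_le h.one_le
  refine ⟨fun huv => ?_, fun ⟨hu, hv⟩ => lt_of_lt_of_le (by positivity) (h.lower u v)⟩
  have h_mul : 0 < μ u * μ v := pos_of_mul_pos_right (huv.trans_le (h.upper u v)) hC.le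
  exact ⟨pos_of_mul_pos_left h_mul (h.nonneg v), pos_of_mul_pos_right h_mul (h.nonneg u)⟩

theorem abs_log_append_sub_le (h : IsQuasiMultiplicative μ C) {u v : List α} (hu : 0 < μ u)
    (hv : 0 < μ v) :
    |Real.log (μ (u ++ v)) - (Real.log (μ u) + Real.log (μ v))| ≤ Real.log C := by
  have hC : 0 < C := one_pos.trans_le h.one_le
  have h_upper := Real.log_le_log (h.append_pos_iff.2 ⟨hu, hv⟩) (h.upper u v)
  have h_lower := Real.log_le_log (by positivity) (h.lower u v)
  rw [Real.log_mul (by positivity) (by positivity), Real.log_mul hu.ne' hv.ne'] at h_upper h_lower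
  rw [one_div, Real.log_inv] at h_lower
  exact abs_le.2 ⟨by linarith, by linarith⟩

theorem partitionSum_pos (h : IsQuasiMultiplicative μ C) (n : ℕ) (q : ℝ) :
    0 < partitionSum μ n q :=
  Finset.sum_pos (fun _ hw => Real.rpow_pos_of_pos (mem_positiveWords.1 hw).2 q)
    (h.positiveWords_nonempty n)

theorem partitionSum_add (h : IsQuasiMultiplicative μ C) (n p : ℕ) (q : ℝ) :
    partitionSum μ (n + p) q =
      ∑ x ∈ positiveWords μ n ×ˢ positiveWords μ p, μ (x.1 ++ x.2) ^ q := by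
  rw [partitionSum, positiveWords, Finset.sum_filter, sum_words_add, ← Finset.sum_filter]
  simp only [h.append_pos_iff, positiveWords, ← Finset.filter_product]

theorem almostAdditive_log_partitionSum (h : IsQuasiMultiplicative μ C) (q : ℝ) :
    AlmostAdditive (fun n => Real.log (partitionSum μ n q)) (|q| * Real.log C) := by
  intro n p
  have h_pos : ∀ x ∈ positiveWords μ n ×ˢ positiveWords μ p, 0 < μ x.1 ∧ 0 < μ x.2 := by
    intro x hx
    rw [Finset.mem_product, mem_positiveWords, mem_positiveWords] at hx
    exact ⟨hx.1.2, hx.2.2⟩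
  have h_prod : partitionSum μ n q * partitionSum μ p q =
      ∑ x ∈ positiveWords μ n ×ˢ positiveWords μ p, μ x.1 ^ q * μ x.2 ^ q :=
    Finset.sum_mul_sum _ _ _ _ |>.trans (Finset.sum_product' ..).symm
  dsimp only
  rw [← Real.log_mul (h.partitionSum_pos n q).ne' (h.partitionSum_pos p q).ne', h_prod,
    h.partitionSum_add]
  refine abs_log_sum_sub_log_sum_le
    ((h.positiveWords_nonempty n).product (h.positiveWords_nonempty p)) ?_ ?_ ?_ <;>
    intro x hx <;> obtain ⟨hu, hv⟩ := h_pos x hx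
  · exact Real.rpow_pos_of_pos (h.append_pos_iff.2 ⟨hu, hv⟩) q
  · positivity
  · rw [Real.log_rpow (h.append_pos_iff.2 ⟨hu, hv⟩), Real.log_mul (by positivity) (by positivity),
      Real.log_rpow hu, Real.log_rpow hv, ← mul_add, ← mul_sub, abs_mul]
    exact mul_le_mul_of_nonneg_left (h.abs_log_append_sub_le hu hv) (abs_nonneg q)

theorem tendsto_pressure (h : IsQuasiMultiplicative μ C) (q : ℝ) :
    Tendsto (fun n : ℕ => Real.log (partitionSum μ n q) / n) atTop (𝓝 (pressure μ q)) := by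
  have h_lim := (h.almostAdditive_log_partitionSum q).tendsto_div
  rwa [pressure, h_lim.limsup_eq]

theorem abs_log_partitionSum_sub_le (h : IsQuasiMultiplicative μ C) (n : ℕ) (q : ℝ) :
    |Real.log (partitionSum μ n q) - n * pressure μ q| ≤ |q| * Real.log C :=
  (h.almostAdditive_log_partitionSum q).abs_sub_mul_lim_le (h.tendsto_pressure q) n

end IsQuasiMultiplicative

end Words

/-! ### Fluctuations of the weights -/

theorem tendsto_sqrt_natCast_atTop : Tendsto (fun n : ℕ => √(n : ℝ)) atTop atTop :=
  Real.tendsto_sqrt_atTop.comp tendsto_natCast_atTop_atTop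

/-- The expansion `f (1 - q) = q d + (v / 2) q² + o(q²)` as `q → 0`. -/
def HasQuadraticExpansion (f : ℝ → ℝ) (d v : ℝ) : Prop :=
  (fun q : ℝ => f (1 - q) - (q * d + v / 2 * q ^ 2)) =o[𝓝 0] fun q : ℝ => q ^ 2

namespace HasQuadraticExpansion

variable {f : ℝ → ℝ} {d v : ℝ}

theorem const_mul (h : HasQuadraticExpansion f d v) (c : ℝ) :
    HasQuadraticExpansion (fun q => c * f q) (c * d) (c * v) := by
  refine (Asymptotics.IsLittleO.const_mul_left h c).congr_left fun q => ?_
  ring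

theorem eventually_abs_sub_le (h : HasQuadraticExpansion f d v) (t : ℝ) :
    ∀ᶠ n : ℕ in atTop, |n * f (1 + t / √n) + t / √n * (n * d) - v * t ^ 2 / 2| ≤ 1 := by
  have h_tendsto : Tendsto (fun n : ℕ => -t / √(n : ℝ)) atTop (𝓝 0) :=
    tendsto_const_nhds.div_atTop tendsto_sqrt_natCast_atTop
  have hε : (0 : ℝ) < 1 / (t ^ 2 + 1) := by positivity
  filter_upwards [h_tendsto.eventually (h.def hε), eventually_gt_atTop 0] with n h_error hn
  have hn_pos : (0 : ℝ) < n := Nat.cast_pos.2 hn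
  have h_sq : n * (-t / √n) ^ 2 = t ^ 2 := by
    rw [div_pow, Real.sq_sqrt hn_pos.le]
    field_simp
  rw [neg_div, sub_neg_eq_add, Real.norm_eq_abs, Real.norm_of_nonneg (sq_nonneg _),
    ← neg_div] at h_error
  calc |(n : ℝ) * f (1 + t / √n) + t / √n * (n * d) - v * t ^ 2 / 2|
      = (n : ℝ) * |f (1 + t / √n) - (-t / √n * d + v / 2 * (-t / √n) ^ 2)| := by
        rw [← abs_of_pos hn_pos, ← abs_mul, abs_of_pos hn_pos, ← h_sq]
        ring_nf
    _ ≤ n * (1 / (t ^ 2 + 1) * (-t / √n) ^ 2) := mul_le_mul_of_nonneg_left h_error hn_pos.le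
    _ = t ^ 2 / (t ^ 2 + 1) := by
        rw [← h_sq]
        ring
    _ ≤ 1 := (div_le_one (by positivity)).2 (by linarith)

end HasQuadraticExpansion

section PaleyZygmund

variable {ι : Type*} {s : Finset ι} {μ : ι → ℝ}

theorem sub_le_sum_filter_le {f : ι → ℝ} (hμ : ∀ i ∈ s, 0 ≤ μ i) (hsum : ∑ i ∈ s, μ i ≤ 1)
    {a : ℝ} (ha : 0 ≤ a) :
    ∑ i ∈ s, μ i * f i - a ≤ ∑ i ∈ s with a ≤ f i, μ i * f i := by
  have h_small : ∑ i ∈ s with ¬a ≤ f i, μ i * f i ≤ a :=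
    calc ∑ i ∈ s with ¬a ≤ f i, μ i * f i
        ≤ ∑ i ∈ s with ¬a ≤ f i, μ i * a := Finset.sum_le_sum fun i hi =>
          mul_le_mul_of_nonneg_left (not_le.1 (Finset.mem_filter.1 hi).2).le
            (hμ i (Finset.mem_filter.1 hi).1)
      _ ≤ ∑ i ∈ s, μ i * a := Finset.sum_le_sum_of_subset_of_nonneg (Finset.filter_subset _ _)
            fun i hi _ => mul_nonneg (hμ i hi) ha
      _ ≤ a := by
          rw [← Finset.sum_mul]
          exact mul_le_of_le_one_left ha hsum
  linarith [Finset.sum_filter_add_sum_filter_not s (fun i => a ≤ f i) fun i => μ i * f i]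

theorem sq_sum_filter_le {f : ι → ℝ} (hμ : ∀ i ∈ s, 0 ≤ μ i) (p : ι → Prop) [DecidablePred p] :
    (∑ i ∈ s with p i, μ i * f i) ^ 2 ≤ (∑ i ∈ s with p i, μ i) * ∑ i ∈ s, μ i * f i ^ 2 := by
  have hμ_filter : ∀ i ∈ s.filter p, 0 ≤ μ i := fun i hi => hμ i (Finset.mem_filter.1 hi).1
  calc (∑ i ∈ s with p i, μ i * f i) ^ 2
      ≤ (∑ i ∈ s with p i, μ i) * ∑ i ∈ s with p i, μ i * f i ^ 2 :=
        Finset.sum_sq_le_sum_mul_sum_of_sq_le_mul _ hμ_filter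
          (fun i hi => mul_nonneg (hμ_filter i hi) (sq_nonneg _))
          fun i _ => le_of_eq (by ring)
    _ ≤ _ := mul_le_mul_of_nonneg_left
        (Finset.sum_le_sum_of_subset_of_nonneg (Finset.filter_subset _ _)
          fun i hi _ => mul_nonneg (hμ i hi) (sq_nonneg _)) (Finset.sum_nonneg hμ_filter)

theorem paley_zygmund {f : ι → ℝ} (hμ : ∀ i ∈ s, 0 ≤ μ i) (hsum : ∑ i ∈ s, μ i ≤ 1)
    (hf : ∀ i ∈ s, 0 ≤ f i) {r : ℝ} (hr₀ : 0 ≤ r) (hr₁ : r ≤ 1) :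
    ((1 - r) * ∑ i ∈ s, μ i * f i) ^ 2 ≤
      (∑ i ∈ s with r * (∑ i ∈ s, μ i * f i) ≤ f i, μ i) * ∑ i ∈ s, μ i * f i ^ 2 := by
  have h_mean : 0 ≤ ∑ i ∈ s, μ i * f i :=
    Finset.sum_nonneg fun i hi => mul_nonneg (hμ i hi) (hf i hi)
  have h_large := sub_le_sum_filter_le (f := f) hμ hsum (mul_nonneg hr₀ h_mean)
  rw [← one_sub_mul] at h_large
  exact (pow_le_pow_left₀ (mul_nonneg (sub_nonneg.2 hr₁) h_mean) h_large 2).trans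
    (sq_sum_filter_le hμ _)

theorem exp_div_four_le_sum_filter_le {X : ι → ℝ} (hμ : ∀ i ∈ s, 0 ≤ μ i)
    (hsum : ∑ i ∈ s, μ i ≤ 1) {v θ A B : ℝ} (hθ : 0 < θ) (hA : A * θ + B + 1 ≤ v * θ ^ 2 / 2)
    (h_first : Real.exp (v * θ ^ 2 / 2 - B) ≤ ∑ i ∈ s, μ i * Real.exp (θ * X i))
    (h_second : ∑ i ∈ s, μ i * Real.exp (2 * θ * X i) ≤ Real.exp (2 * v * θ ^ 2 + B)) :
    Real.exp (-(v * θ ^ 2) - 3 * B) / 4 ≤ ∑ i ∈ s with A ≤ X i, μ i := by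
  have h_pz := paley_zygmund hμ hsum (fun i _ => (Real.exp_pos (θ * X i)).le)
    one_half_pos.le one_half_lt_one.le
  set M := ∑ i ∈ s, μ i * Real.exp (θ * X i)
  have h_sq : ∑ i ∈ s, μ i * Real.exp (θ * X i) ^ 2 ≤ Real.exp (2 * v * θ ^ 2 + B) := by
    simpa only [← Real.exp_nat_mul, Nat.cast_ofNat, ← mul_assoc] using h_second
  have h_imp : ∀ i, 1 / 2 * M ≤ Real.exp (θ * X i) → A ≤ X i := by
    intro i hi
    have h_exp : Real.exp (v * θ ^ 2 / 2 - B) ≤ Real.exp (θ * X i + 1) := by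
      rw [Real.exp_add]
      nlinarith [Real.add_one_le_exp 1, Real.exp_pos (θ * X i)]
    rw [Real.exp_le_exp] at h_exp
    nlinarith
  have h_mass : ∑ i ∈ s with 1 / 2 * M ≤ Real.exp (θ * X i), μ i ≤ ∑ i ∈ s with A ≤ X i, μ i :=
    Finset.sum_le_sum_of_subset_of_nonneg (Finset.monotone_filter_right s fun i _ => h_imp i)
      fun i hi _ => hμ i (Finset.mem_filter.1 hi).1
  have h_chain : Real.exp (-(v * θ ^ 2) - 3 * B) / 4 * Real.exp (2 * v * θ ^ 2 + B) ≤
      (∑ i ∈ s with A ≤ X i, μ i) * Real.exp (2 * v * θ ^ 2 + B) :=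
    calc Real.exp (-(v * θ ^ 2) - 3 * B) / 4 * Real.exp (2 * v * θ ^ 2 + B)
        = (Real.exp (v * θ ^ 2 / 2 - B) / 2) ^ 2 := by
          rw [div_pow, div_mul_eq_mul_div, ← Real.exp_add, ← Real.exp_nat_mul]
          ring_nf
      _ ≤ ((1 - 1 / 2) * M) ^ 2 := by
          refine pow_le_pow_left₀ (by positivity) ?_ 2
          linarith
      _ ≤ _ := h_pz.trans (mul_le_mul h_mass h_sq
          (Finset.sum_nonneg fun i hi => mul_nonneg (hμ i hi) (sq_nonneg _))
          (Finset.sum_nonneg fun i hi => hμ i (Finset.mem_filter.1 hi).1))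
  exact le_of_mul_le_mul_right h_chain (Real.exp_pos _)

end PaleyZygmund

section Deviation

variable {α : Type*} {μ : List α → ℝ} {C d s A v : ℝ}

/-- The logarithm of the ratio of `μ w` to its typical size `exp (-n d)`, where `n` is the length
of `w`. -/
def deviation (μ : List α → ℝ) (d : ℝ) (w : List α) : ℝ :=
  Real.log (μ w) + w.length * d

/-- The words of positive weight whose deviation is, in the direction of the sign `s`, at least
`A` times the square root of the length. -/
def deviatingWords (μ : List α → ℝ) (d s A : ℝ) : Set (List α) :=
  {w | 0 < μ w ∧ A * √w.length ≤ s * deviation μ d w}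

variable [Finite α]

theorem IsQuasiMultiplicative.sum_mul_exp_deviation (h : IsQuasiMultiplicative μ C) (n : ℕ)
    (d t : ℝ) :
    ∑ w ∈ positiveWords μ n, μ w * Real.exp (t * deviation μ d w) =
      Real.exp (Real.log (partitionSum μ n (1 + t)) + t * (n * d)) := by
  rw [Real.exp_add, Real.exp_log (h.partitionSum_pos n _), partitionSum, Finset.sum_mul]
  refine Finset.sum_congr rfl fun w hw => ?_
  obtain ⟨hw_len, hw_pos⟩ := mem_positiveWords.1 hw
  rw [deviation, hw_len, mul_add, Real.exp_add, ← mul_assoc, Real.rpow_add hw_pos, Real.rpow_one,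
    Real.rpow_def_of_pos hw_pos t, mul_comm t]

/-- `exp (v t² / 2)` is the moment generating function of the centred Gaussian law of
variance `v`. -/
theorem IsQuasiMultiplicative.eventually_sum_mul_exp_mem_Icc
    (h : IsQuasiMultiplicative μ C) (hμ : HasQuadraticExpansion (pressure μ) d v) (t : ℝ) :
    ∀ᶠ n : ℕ in atTop,
      ∑ w ∈ positiveWords μ n, μ w * Real.exp (t / √n * deviation μ d w) ∈
        Set.Icc (Real.exp (v * t ^ 2 / 2 - (2 * Real.log C + 1)))
          (Real.exp (v * t ^ 2 / 2 + (2 * Real.log C + 1))) := by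
  have h_tendsto : Tendsto (fun n : ℕ => |1 + t / √(n : ℝ)|) atTop (𝓝 |1 + 0|) :=
    (tendsto_const_nhds.add (tendsto_const_nhds.div_atTop tendsto_sqrt_natCast_atTop)).abs
  filter_upwards [hμ.eventually_abs_sub_le t, h_tendsto.eventually_le_const (u := 2) (by norm_num)]
    with n h_expansion h_two
  have h_pressure := (h.abs_log_partitionSum_sub_le n (1 + t / √n)).trans
    (mul_le_mul_of_nonneg_right h_two (Real.log_nonneg h.one_le))
  rw [h.sum_mul_exp_deviation, Set.mem_Icc, Real.exp_le_exp, Real.exp_le_exp]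
  rw [abs_le] at h_expansion h_pressure
  exact ⟨by linarith, by linarith⟩

open scoped Classical in
theorem IsQuasiMultiplicative.exists_eventually_le_sum_deviatingWords
    (h : IsQuasiMultiplicative μ C) (hv : 0 < v) (hμ : HasQuadraticExpansion (pressure μ) d v)
    (hs : |s| = 1) (A : ℝ) :
    ∃ c > 0, ∀ᶠ n : ℕ in atTop, c ≤ ∑ w ∈ words α n with w ∈ deviatingWords μ d s A, μ w := by
  set B := 2 * Real.log C + 1
  obtain ⟨θ, hθ, hAθ⟩ : ∃ θ : ℝ, 0 < θ ∧ A * θ + B + 1 ≤ v * θ ^ 2 / 2 := by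
    have h_tendsto : Tendsto (fun θ : ℝ => θ * (v / 2 * θ - A)) atTop atTop :=
      tendsto_id.atTop_mul_atTop₀ <|
        tendsto_atTop_add_const_right _ _ (tendsto_id.const_mul_atTop (half_pos hv))
    obtain ⟨θ, hθ_ge, hθ⟩ :=
      ((h_tendsto.eventually_ge_atTop (B + 1)).and (eventually_gt_atTop 0)).exists
    exact ⟨θ, hθ, by linarith⟩
  have h_moment := h.eventually_sum_mul_exp_mem_Icc hμ
  have h_sθ : (s * θ) ^ 2 = θ ^ 2 := by rw [mul_pow, ← sq_abs s, hs, one_pow, one_mul]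
  refine ⟨Real.exp (-(v * θ ^ 2) - 3 * B) / 4, by positivity, ?_⟩
  filter_upwards [h_moment (s * θ), h_moment (2 * (s * θ)), eventually_gt_atTop 0]
    with n h_first h_second hn
  have h_sqrt : 0 < √(n : ℝ) := Real.sqrt_pos.2 (Nat.cast_pos.2 hn)
  have h_scale₁ : ∀ w, θ * (s * deviation μ d w / √n) = s * θ / √n * deviation μ d w :=
    fun w => by ring
  have h_scale₂ : ∀ w, 2 * θ * (s * deviation μ d w / √n) =
      2 * (s * θ) / √n * deviation μ d w := fun w => by ring
  rw [h_sθ] at h_first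
  rw [mul_pow, h_sθ, show v * (2 ^ 2 * θ ^ 2) / 2 = 2 * v * θ ^ 2 by ring] at h_second
  have h_pz := exp_div_four_le_sum_filter_le (s := positiveWords μ n) (μ := μ)
    (X := fun w => s * deviation μ d w / √n) (fun w _ => h.nonneg w) (h.sum_positiveWords n).le
    hθ hAθ (by simpa only [h_scale₁] using h_first.1)
    (by simpa only [h_scale₂] using h_second.2)
  refine h_pz.trans (Finset.sum_le_sum_of_subset_of_nonneg ?_ fun w _ _ => h.nonneg w)
  intro w hw
  simp only [Finset.mem_filter, mem_positiveWords, mem_words] at hw ⊢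
  obtain ⟨⟨rfl, hw_pos⟩, hw_dev⟩ := hw
  exact ⟨rfl, hw_pos, (le_div_iff₀ h_sqrt).1 hw_dev⟩

theorem sqrt_add_le_add_sqrt {x y : ℝ} (hx : 0 ≤ x) (hy : 0 ≤ y) : √(x + y) ≤ √x + √y := by
  rw [Real.sqrt_le_left (by positivity)]
  nlinarith [Real.sq_sqrt hx, Real.sq_sqrt hy, mul_nonneg (Real.sqrt_nonneg x) (Real.sqrt_nonneg y)]

theorem IsQuasiMultiplicative.append_mem_deviatingWords (h : IsQuasiMultiplicative μ C)
    (hs : |s| = 1) {u w : List α} (hu : 0 < μ u) (hw : w ∈ deviatingWords μ d s (A + 1))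
    (h_len : |A| * √u.length + |deviation μ d u| + Real.log C ≤ √w.length) :
    u ++ w ∈ deviatingWords μ d s A := by
  obtain ⟨hw_pos, hw_dev⟩ := hw
  refine ⟨h.append_pos_iff.2 ⟨hu, hw_pos⟩, ?_⟩
  have h_sqrt : A * √(u ++ w).length ≤ A * √w.length + |A| * √u.length := by
    have h_incr : |√(u ++ w).length - √w.length| ≤ √u.length := by
      rw [List.length_append, Nat.cast_add, abs_of_nonneg]
      · linarith [sqrt_add_le_add_sqrt (Nat.cast_nonneg' (α := ℝ) u.length)
          (Nat.cast_nonneg' w.length)]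
      · exact sub_nonneg.2 (Real.sqrt_le_sqrt (by simp))
    have := (le_abs_self _).trans_eq (abs_mul A (√(u ++ w).length - √w.length))
    nlinarith [mul_le_mul_of_nonneg_left h_incr (abs_nonneg A)]
  have h_log : |s * (deviation μ d (u ++ w) - deviation μ d w)| ≤
      |deviation μ d u| + Real.log C := by
    rw [abs_mul, hs, one_mul]
    have h_append := h.abs_log_append_sub_le hu hw_pos
    have h_eq : deviation μ d (u ++ w) - deviation μ d w = deviation μ d u +
        (Real.log (μ (u ++ w)) - (Real.log (μ u) + Real.log (μ w))) := by
      simp only [deviation, List.length_append, Nat.cast_add]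
      ring
    rw [h_eq]
    exact (abs_add_le _ _).trans (by gcongr)
  linarith [(abs_le.1 h_log).1]

open scoped Classical in
theorem IsQuasiMultiplicative.exists_forall_eventually_mul_le_sum_append
    (h : IsQuasiMultiplicative μ C) (hv : 0 < v) (hμ : HasQuadraticExpansion (pressure μ) d v)
    (hs : |s| = 1) (A : ℝ) :
    ∃ c > 0, ∀ u, ∀ᶠ n : ℕ in atTop,
      c * μ u ≤ ∑ w ∈ words α n with u ++ w ∈ deviatingWords μ d s A, μ (u ++ w) := by
  obtain ⟨c, hc, h_sum⟩ := h.exists_eventually_le_sum_deviatingWords hv hμ hs (A + 1)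
  have hC : 0 < C := one_pos.trans_le h.one_le
  refine ⟨1 / C * c, by positivity, fun u => ?_⟩
  obtain hu | hu := (h.nonneg u).eq_or_lt
  · rw [← hu, mul_zero]
    exact .of_forall fun n => Finset.sum_nonneg fun w _ => h.nonneg _
  filter_upwards [h_sum, tendsto_sqrt_natCast_atTop.eventually_ge_atTop
    (|A| * √u.length + |deviation μ d u| + Real.log C)] with n hn h_large
  calc 1 / C * c * μ u
      ≤ 1 / C * μ u * ∑ w ∈ words α n with w ∈ deviatingWords μ d s (A + 1), μ w := by
        rw [mul_right_comm]
        gcongr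
    _ ≤ ∑ w ∈ words α n with w ∈ deviatingWords μ d s (A + 1), μ (u ++ w) := by
        rw [Finset.mul_sum]
        exact Finset.sum_le_sum fun w _ => by linarith [h.lower u w]
    _ ≤ _ := Finset.sum_le_sum_of_subset_of_nonneg (Finset.monotone_filter_right _
        fun w hw hw_dev => h.append_mem_deviatingWords hs hu hw_dev (mem_words.1 hw ▸ h_large))
        fun w _ _ => h.nonneg _

end Deviation

/-! ### Nested partitions -/

/-- A nested sequence of partitions, up to `m`-null sets, the cells of the `n`-th one being indexed
by the words of length `n`. -/
structure IsNestedPartition {X α : Type*} [MeasurableSpace X] (m : Measure X)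
    (I : List α → Set X) : Prop where
  measurableSet : ∀ w, MeasurableSet (I w)
  append_subset : ∀ u v, I (u ++ v) ⊆ I u
  disjoint : ∀ ⦃u v⦄, u.length = v.length → u ≠ v → Disjoint (I u) (I v)
  ae_exists_mem : ∀ n, ∀ᵐ x ∂m, ∃ w, w.length = n ∧ x ∈ I w

namespace IsNestedPartition

variable {X α : Type*} [MeasurableSpace X] {m : Measure X} {I : List α → Set X}

theorem subset_of_mem (h : IsNestedPartition m I) {u w : List α} (h_len : w.length ≤ u.length)
    {x : X} (hxu : x ∈ I u) (hxw : x ∈ I w) : I u ⊆ I w := by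
  have h_take : I u ⊆ I (u.take w.length) := by
    simpa only [List.take_append_drop] using h.append_subset (u.take w.length) (u.drop w.length)
  have h_eq : u.take w.length = w := by
    by_contra h_ne
    exact Set.disjoint_left.1 (h.disjoint (by simpa using h_len) h_ne) (h_take hxu) hxw
  rwa [h_eq] at h_take

variable [Finite α]

theorem pairwiseDisjoint_words (h : IsNestedPartition m I) (n : ℕ) :
    (words α n : Set (List α)).PairwiseDisjoint I := fun u hu v hv huv => by
  rw [Finset.mem_coe, mem_words] at hu hv
  exact h.disjoint (hu.trans hv.symm) huv

theorem measurableSet_biUnion (h : IsNestedPartition m I) (S : Set (List α)) :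
    MeasurableSet (⋃ w ∈ S, I w) :=
  .biUnion S.to_countable fun w _ => h.measurableSet w

theorem sum_measureReal [IsFiniteMeasure m] (h : IsNestedPartition m I) (n : ℕ) :
    ∑ w ∈ words α n, m.real (I w) = m.real Set.univ := by
  rw [← measureReal_biUnion_finset (h.pairwiseDisjoint_words n) fun w _ => h.measurableSet w]
  refine measureReal_congr (eventuallyEq_univ.2 ?_)
  filter_upwards [h.ae_exists_mem n] with x hx
  simpa using hx

section UnionOfCells

variable [IsFiniteMeasure m] {S : Set (List α)}

open scoped Classical in
theorem measureReal_compl_biUnion_le (h : IsNestedPartition m I) (S : Set (List α)) (n : ℕ) :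
    m.real (⋃ w ∈ S, I w)ᶜ ≤
      ∑ u ∈ words α n with Disjoint (I u) (⋃ w ∈ {w ∈ S | w.length ≤ n}, I w), m.real (I u) := by
  refine le_trans (ENNReal.toReal_mono (measure_ne_top _ _) (measure_mono_ae ?_))
    (measureReal_biUnion_finset_le _ _)
  filter_upwards [h.ae_exists_mem n] with x ⟨u, hu, hxu⟩ hx
  have h_disjoint : Disjoint (I u) (⋃ w ∈ {w ∈ S | w.length ≤ n}, I w) := by
    refine Set.disjoint_iUnion₂_right.2 fun w hw => Set.disjoint_left.2 fun y hyu hyw => hx ?_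
    exact Set.mem_biUnion hw.1 (h.subset_of_mem (hw.2.trans hu.ge) hyu hyw hxu)
  exact Set.mem_biUnion (Finset.mem_coe.2 (Finset.mem_filter.2 ⟨mem_words.2 hu, h_disjoint⟩)) hxu

theorem mul_measureReal_compl_biUnion_le (h : IsNestedPartition m I) {c : ℝ} (hc : 0 ≤ c)
    (hS : ∀ u, c * m.real (I u) ≤ m.real ((⋃ w ∈ S, I w) ∩ I u)) (n : ℕ) :
    c * m.real (⋃ w ∈ S, I w)ᶜ ≤
      m.real ((⋃ w ∈ S, I w) \ ⋃ w ∈ {w ∈ S | w.length ≤ n}, I w) := by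
  classical
  set T := (words α n).filter fun u => Disjoint (I u) (⋃ w ∈ {w ∈ S | w.length ≤ n}, I w)
  have hT : (T : Set (List α)).PairwiseDisjoint fun u => (⋃ w ∈ S, I w) ∩ I u :=
    ((h.pairwiseDisjoint_words n).subset (Finset.coe_subset.2 (Finset.filter_subset _ _))).mono
      fun u => Set.inter_subset_right
  calc c * m.real (⋃ w ∈ S, I w)ᶜ ≤ ∑ u ∈ T, c * m.real (I u) := by
        rw [← Finset.mul_sum]
        exact mul_le_mul_of_nonneg_left (h.measureReal_compl_biUnion_le S n) hc
    _ ≤ ∑ u ∈ T, m.real ((⋃ w ∈ S, I w) ∩ I u) := Finset.sum_le_sum fun u _ => hS u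
    _ = m.real (⋃ u ∈ T, (⋃ w ∈ S, I w) ∩ I u) := (measureReal_biUnion_finset hT
        fun u _ => (h.measurableSet_biUnion S).inter (h.measurableSet u)).symm
    _ ≤ m.real ((⋃ w ∈ S, I w) \ ⋃ w ∈ {w ∈ S | w.length ≤ n}, I w) := by
        refine measureReal_mono (Set.iUnion₂_subset fun u hu x hx => ⟨hx.1, ?_⟩)
        exact Set.disjoint_left.1 (Finset.mem_filter.1 hu).2 hx.2

theorem tendsto_measureReal_biUnion_sdiff (h : IsNestedPartition m I) (S : Set (List α)) :
    Tendsto (fun n : ℕ => m.real ((⋃ w ∈ S, I w) \ ⋃ w ∈ {w ∈ S | w.length ≤ n}, I w))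
      atTop (𝓝 0) := by
  have h_anti : Antitone fun n : ℕ => (⋃ w ∈ S, I w) \ ⋃ w ∈ {w ∈ S | w.length ≤ n}, I w :=
    fun n p hnp => Set.sdiff_subset_sdiff_right <|
      Set.biUnion_subset_biUnion_left fun w hw => ⟨hw.1, hw.2.trans hnp⟩
  have h_empty : ⋂ n : ℕ, ((⋃ w ∈ S, I w) \ ⋃ w ∈ {w ∈ S | w.length ≤ n}, I w) = ∅ := by
    refine Set.eq_empty_of_forall_notMem fun x hx => ?_
    obtain ⟨w, hw, hxw⟩ := Set.mem_iUnion₂.1 (Set.mem_iInter.1 hx 0).1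
    exact (Set.mem_iInter.1 hx w.length).2 (Set.mem_biUnion ⟨hw, le_rfl⟩ hxw)
  have h_lim := tendsto_measure_iInter_atTop (μ := m)
    (fun n => ((h.measurableSet_biUnion S).diff (h.measurableSet_biUnion _)).nullMeasurableSet)
    h_anti ⟨0, measure_ne_top _ _⟩
  rw [h_empty, measure_empty] at h_lim
  exact (ENNReal.tendsto_toReal ENNReal.zero_ne_top).comp h_lim

theorem ae_exists_mem_of_mul_le (h : IsNestedPartition m I) {c : ℝ} (hc : 0 < c)
    (hS : ∀ u, c * m.real (I u) ≤ m.real ((⋃ w ∈ S, I w) ∩ I u)) :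
    ∀ᵐ x ∂m, ∃ w ∈ S, x ∈ I w := by
  have h_mul : c * m.real (⋃ w ∈ S, I w)ᶜ ≤ 0 :=
    ge_of_tendsto' (h.tendsto_measureReal_biUnion_sdiff S)
      (h.mul_measureReal_compl_biUnion_le hc.le hS)
  have h_zero : m.real (⋃ w ∈ S, I w)ᶜ = 0 :=
    (nonpos_of_mul_nonpos_right h_mul hc).antisymm measureReal_nonneg
  filter_upwards [mem_ae_iff.2 ((measureReal_eq_zero_iff).1 h_zero)] with x hx
  simpa using hx

end UnionOfCells

theorem ae_forall_exists_mem_deviatingWords [IsFiniteMeasure m] (h : IsNestedPartition m I) {C : ℝ}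
    (hm : IsQuasiMultiplicative (fun w => m.real (I w)) C) {d v s : ℝ} (hv : 0 < v)
    (h_pressure : HasQuadraticExpansion (pressure fun w => m.real (I w)) d v) (hs : |s| = 1)
    (A : ℝ) :
    ∀ᵐ x ∂m, ∀ N, ∃ w ∈ deviatingWords (fun w => m.real (I w)) d s A, N ≤ w.length ∧ x ∈ I w := by
  classical
  obtain ⟨c, hc, h_sum⟩ := hm.exists_forall_eventually_mul_le_sum_append hv h_pressure hs A
  refine ae_all_iff.2 fun N => ?_
  simp only [← and_assoc]
  refine h.ae_exists_mem_of_mul_le hc fun u => ?_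
  obtain ⟨n, hn, hN⟩ := ((h_sum u).and (eventually_ge_atTop N)).exists
  set T := (words α n).filter fun w =>
    u ++ w ∈ deviatingWords (fun w => m.real (I w)) d s A
  have hT : (T : Set (List α)).PairwiseDisjoint fun w => I (u ++ w) := by
    intro w hw w' hw' h_ne
    have h_len := (mem_words.1 (Finset.mem_filter.1 hw).1).trans
      (mem_words.1 (Finset.mem_filter.1 hw').1).symm
    exact h.disjoint (by simpa using h_len) fun h_eq => h_ne (List.append_cancel_left h_eq)
  refine hn.trans ?_
  rw [← measureReal_biUnion_finset hT fun w _ => h.measurableSet _]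
  refine measureReal_mono (Set.iUnion₂_subset fun w hw => ?_)
  obtain ⟨hw_len, hw_dev⟩ := Finset.mem_filter.1 hw
  refine Set.subset_inter (Set.subset_biUnion_of_mem (u := I) ?_) (h.append_subset u w)
  exact ⟨hw_dev, by rw [List.length_append, mem_words.1 hw_len]; omega⟩

end IsNestedPartition

/-! ### Null sets of gauge measures -/

section GaugeNull

variable {X : Type*} [MetricSpace X] [MeasurableSpace X] {ψ : ℝ → ℝ}

theorem hausdorffGauge_setOf_frequently_mem_eq_zero [BorelSpace X] {ι : Type*} [Countable ι]
    {U : ι → Set X} (h_ediam : Tendsto (fun i => Metric.ediam (U i)) cofinite (𝓝 0))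
    (h_sum : ∑' i, ENNReal.ofReal (ψ (Metric.diam (U i))) ≠ ⊤) :
    hausdorffGauge ψ {x | ∃ᶠ i in cofinite, x ∈ U i} = 0 := by
  set r : Finset ι → ℝ≥0∞ := fun s => ⨆ i : {i // i ∉ s}, Metric.ediam (U i)
  have hr : Tendsto r atTop (𝓝 0) := by
    refine ENNReal.tendsto_nhds_zero.2 fun ε hε => ?_
    have h_fin := eventually_cofinite.1 (ENNReal.tendsto_nhds_zero.1 h_ediam ε hε)
    filter_upwards [eventually_ge_atTop h_fin.toFinset] with s hs
    refine iSup_le fun i => ?_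
    by_contra h_lt
    exact i.2 (hs (h_fin.mem_toFinset.2 h_lt))
  have h_le := Measure.mkMetric_le_liminf_tsum {x | ∃ᶠ i in cofinite, x ∈ U i} r hr
    (fun s (i : {i // i ∉ s}) => U i) (Eventually.of_forall fun s => le_iSup _)
    (Eventually.of_forall fun s x hx => by
      obtain ⟨i, his, hxi⟩ := (frequently_cofinite_iff_infinite.1 hx).exists_notMem_finset s
      exact Set.mem_iUnion.2 ⟨⟨i, hxi⟩, his⟩)
    fun t => ENNReal.ofReal (ψ t.toReal)
  exact nonpos_iff_eq_zero.1
    (h_le.trans_eq (ENNReal.tendsto_tsum_compl_atTop_zero h_sum).liminf_eq)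

variable {m : Measure X} [IsFiniteMeasure m]

theorem measure_le_mul_packingAt [TopologicalSpace.SeparableSpace X] {E : Set X} {ε δ : ℝ}
    (hε : 0 ≤ ε) (hE : ∀ x ∈ E, ∃ r, 0 < r ∧ r ≤ δ ∧
      m.real (Metric.closedBall x (5 * r)) ≤ ε * ψ (2 * r)) :
    m E ≤ ENNReal.ofReal ε * packingAt ψ δ E := by
  obtain ⟨p, hp, hp_disjoint, hp_cover⟩ :=
    Vitali.exists_disjoint_subfamily_covering_enlargement_closedBall
      {b : X × ℝ | b.1 ∈ E ∧ 0 < b.2 ∧ b.2 ≤ δ ∧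
        m.real (Metric.closedBall b.1 (5 * b.2)) ≤ ε * ψ (2 * b.2)}
      Prod.fst Prod.snd δ (fun b hb => hb.2.2.1) 5 (by norm_num)
  have hp_countable : p.Countable := hp_disjoint.countable_of_nonempty_interior fun b hb =>
    ⟨b.1, Metric.ball_subset_interior_closedBall (Metric.mem_ball_self (hp hb).2.1)⟩
  have h_packing : IsPacking δ E p := ⟨hp_countable, fun b hb => (hp hb).1,
    fun b hb => (hp hb).2.1, fun b hb => (hp hb).2.2.1, hp_disjoint⟩
  have h_cover : E ⊆ ⋃ b ∈ p, Metric.closedBall b.1 (5 * b.2) := by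
    intro x hx
    obtain ⟨r, hr, hrδ, hψ⟩ := hE x hx
    obtain ⟨b, hb, h_sub⟩ := hp_cover (x, r) ⟨hx, hr, hrδ, hψ⟩
    exact Set.mem_biUnion hb (h_sub (Metric.mem_closedBall_self hr.le))
  calc m E ≤ ∑' b : p, m (Metric.closedBall b.1.1 (5 * b.1.2)) :=
        (measure_mono h_cover).trans (measure_biUnion_le m hp_countable _)
    _ ≤ ∑' b : p, ENNReal.ofReal ε * ENNReal.ofReal (ψ (2 * b.1.2)) := by
        refine ENNReal.tsum_le_tsum fun b => ?_
        rw [← ENNReal.ofReal_mul hε, ← ofReal_measureReal]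
        exact ENNReal.ofReal_le_ofReal (hp b.2).2.2.2
    _ = ENNReal.ofReal ε * ∑' b : p, ENNReal.ofReal (ψ (2 * b.1.2)) := ENNReal.tsum_mul_left
    _ ≤ ENNReal.ofReal ε * packingAt ψ δ E := by
        gcongr
        exact le_iSup₂ (f := fun (p : Set (X × ℝ)) (_ : IsPacking δ E p) =>
          ∑' b : p, ENNReal.ofReal (ψ (2 * b.1.2))) p h_packing

/-- The lower density of `m` at `x` with respect to the gauge `ψ` vanishes. The factor `5` is the
enlargement needed in the Vitali covering lemma. -/
def HasVanishingLowerDensity (m : Measure X) (ψ : ℝ → ℝ) (x : X) : Prop :=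
  ∀ ε > 0, ∃ᶠ r in 𝓝[>] (0 : ℝ), m.real (Metric.closedBall x (5 * r)) ≤ ε * ψ (2 * r)

theorem measure_eq_zero_of_packingPre_ne_top [TopologicalSpace.SeparableSpace X] {E : Set X}
    (h_fin : packingPre ψ E ≠ ⊤) (hE : ∀ x ∈ E, HasVanishingLowerDensity m ψ x) : m E = 0 := by
  obtain ⟨δ, hδ, hδ_fin⟩ : ∃ δ : ℝ, 0 < δ ∧ packingAt ψ δ E < ⊤ := by
    simpa [packingPre, iInf_lt_iff] using h_fin.lt_top
  have h_le : ∀ ε : ℝ, 0 < ε → m E ≤ ENNReal.ofReal ε * packingAt ψ δ E := fun ε hε =>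
    measure_le_mul_packingAt hε.le fun x hx => by
      obtain ⟨r, hr, hr_mem⟩ := ((hE x hx ε hε).and_eventually (Ioc_mem_nhdsGT hδ)).exists
      exact ⟨r, hr_mem.1, hr_mem.2, hr⟩
  have h_lim : Tendsto (fun ε : ℝ => ENNReal.ofReal ε * packingAt ψ δ E) (𝓝[>] 0) (𝓝 0) := by
    have h_ofReal : Tendsto ENNReal.ofReal (𝓝[>] 0) (𝓝 0) := by
      simpa using (ENNReal.continuous_ofReal.tendsto 0).mono_left nhdsWithin_le_nhds
    simpa using ENNReal.Tendsto.mul_const h_ofReal (Or.inr hδ_fin.ne)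
  refine nonpos_iff_eq_zero.1 (ge_of_tendsto h_lim ?_)
  filter_upwards [self_mem_nhdsWithin] using h_le

theorem absolutelyContinuous_packingGauge [BorelSpace X] [TopologicalSpace.SeparableSpace X]
    (h : ∀ᵐ x ∂m, HasVanishingLowerDensity m ψ x) : m ≪ packingGauge ψ := by
  refine Measure.AbsolutelyContinuous.mk fun s hs h_zero => ?_
  rw [packingGauge, toMeasure_apply _ _ hs, packingOuter, OuterMeasure.ofFunction_apply] at h_zero
  obtain ⟨U, hU, h_sum⟩ : ∃ U : ℕ → Set X, s ⊆ ⋃ i, U i ∧ ∑' i, packingPre ψ (U i) < ⊤ := by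
    simpa [iInf_lt_iff] using h_zero.trans_lt ENNReal.zero_lt_top
  set F := {x | HasVanishingLowerDensity m ψ x}
  have h_null : ∀ i, m (U i ∩ F) = 0 := fun i =>
    measure_eq_zero_of_packingPre_ne_top
      (ne_top_of_le_ne_top (ENNReal.ne_top_of_tsum_ne_top h_sum.ne i)
        (packingPre_mono ψ Set.inter_subset_left)) fun x hx => hx.2
  refine measure_mono_null (t := Fᶜ ∪ ⋃ i, U i ∩ F) (fun x hx => ?_)
    (measure_union_null (mem_ae_iff.1 h) (measure_iUnion_null h_null))
  rw [← Set.iUnion_inter]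
  exact (em (x ∈ F)).symm.imp_right fun hxF => ⟨hU hx, hxF⟩

end GaugeNull

/-! ### Adic cubes -/

/-- The half-open unit cube `[0,1)^D`. -/
def unitCube (D : ℕ) : Set (EuclideanSpace ℝ (Fin D)) :=
  {x | ∀ i, x i ∈ Set.Ico (0 : ℝ) 1}

theorem dist_le_sqrt_card_mul {ι : Type*} [Fintype ι] {x y : EuclideanSpace ℝ ι} {r : ℝ}
    (hr : 0 ≤ r) (h : ∀ i, dist (x i) (y i) ≤ r) : dist x y ≤ √(Fintype.card ι) * r := by
  rw [EuclideanSpace.dist_eq, Real.sqrt_le_left (by positivity), mul_pow,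
    Real.sq_sqrt (Nat.cast_nonneg _)]
  calc ∑ i, dist (x i) (y i) ^ 2 ≤ ∑ _i : ι, r ^ 2 :=
        Finset.sum_le_sum fun i _ => pow_le_pow_left₀ dist_nonneg (h i) 2
    _ = Fintype.card ι * r ^ 2 := by simp

section Cubes

variable {D ℓ n : ℕ}

theorem measurableSet_unitCube : MeasurableSet (unitCube D) := by
  rw [unitCube, Set.ofPred_forall]
  exact .iInter fun i =>
    (by fun_prop : Measurable fun x : EuclideanSpace ℝ (Fin D) => x i) measurableSet_Ico

theorem measurableSet_adicCube (k : Fin D → Fin (ℓ ^ n)) : MeasurableSet (adicCube D ℓ n k) := by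
  rw [adicCube, Set.ofPred_forall]
  exact .iInter fun i =>
    (by fun_prop : Measurable fun x : EuclideanSpace ℝ (Fin D) => x i) measurableSet_Ico

theorem mem_adicCube_iff (hℓ : 0 < ℓ) {k : Fin D → Fin (ℓ ^ n)} {x : EuclideanSpace ℝ (Fin D)} :
    x ∈ adicCube D ℓ n k ↔ ∀ i, 0 ≤ x i ∧ ⌊x i * (ℓ : ℝ) ^ n⌋₊ = k i := by
  have h_pos : (0 : ℝ) < (ℓ : ℝ) ^ n := by positivity
  refine forall_congr' fun i => ?_
  rw [Set.mem_Ico, div_le_iff₀ h_pos, lt_div_iff₀ h_pos]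
  constructor
  · rintro ⟨h_lower, h_upper⟩
    have h_nonneg : 0 ≤ x i * (ℓ : ℝ) ^ n := (Nat.cast_nonneg _).trans h_lower
    exact ⟨nonneg_of_mul_nonneg_left h_nonneg h_pos,
      (Nat.floor_eq_iff h_nonneg).2 ⟨h_lower, h_upper⟩⟩
  · rintro ⟨h_nonneg, h_floor⟩
    exact (Nat.floor_eq_iff (by positivity)).1 h_floor

theorem pairwise_disjoint_adicCube (hℓ : 0 < ℓ) :
    Pairwise (Function.onFun Disjoint (adicCube D ℓ n)) := by
  refine fun k k' h_ne => Set.disjoint_left.2 fun x hx hx' => h_ne ?_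
  rw [mem_adicCube_iff hℓ] at hx hx'
  exact funext fun i => Fin.ext ((hx i).2.symm.trans (hx' i).2)

theorem adicCube_nonempty (hℓ : 0 < ℓ) (k : Fin D → Fin (ℓ ^ n)) : (adicCube D ℓ n k).Nonempty :=
  ⟨WithLp.toLp 2 fun i => (k i : ℕ) / (ℓ : ℝ) ^ n, fun _ =>
    ⟨le_rfl, div_lt_div_of_pos_right (lt_add_one _) (by positivity)⟩⟩

theorem adicCube_injective (hℓ : 0 < ℓ) : Function.Injective (adicCube D ℓ n) := by
  intro k k' h_eq
  by_contra h_ne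
  have h_disjoint := pairwise_disjoint_adicCube hℓ h_ne
  rw [Function.onFun, h_eq, disjoint_self] at h_disjoint
  exact (adicCube_nonempty hℓ k').ne_empty h_disjoint

theorem exists_mem_adicCube (hℓ : 0 < ℓ) (n : ℕ) {x : EuclideanSpace ℝ (Fin D)}
    (hx : x ∈ unitCube D) : ∃ k, x ∈ adicCube D ℓ n k := by
  have h_pos : (0 : ℝ) < (ℓ : ℝ) ^ n := by positivity
  refine ⟨fun i => ⟨⌊x i * (ℓ : ℝ) ^ n⌋₊, ?_⟩, (mem_adicCube_iff hℓ).2 fun i => ⟨(hx i).1, rfl⟩⟩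
  rw [Nat.floor_lt (mul_nonneg (hx i).1 h_pos.le), Nat.cast_pow]
  exact mul_lt_of_lt_one_left h_pos (hx i).2

theorem dist_le_of_mem_adicCube {k : Fin D → Fin (ℓ ^ n)} {x y : EuclideanSpace ℝ (Fin D)}
    (hx : x ∈ adicCube D ℓ n k) (hy : y ∈ adicCube D ℓ n k) :
    dist x y ≤ √D * ((ℓ : ℝ) ^ n)⁻¹ := by
  have h_coord : ∀ i, dist (x i) (y i) ≤ ((ℓ : ℝ) ^ n)⁻¹ := fun i => by
    have hxi := hx i
    have hyi := hy i
    rw [Set.mem_Ico, add_div, one_div] at hxi hyi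
    rw [Real.dist_eq, abs_le]
    constructor <;> linarith
  simpa using dist_le_sqrt_card_mul (by positivity) h_coord

theorem ediam_adicCube_le (k : Fin D → Fin (ℓ ^ n)) :
    Metric.ediam (adicCube D ℓ n k) ≤ ENNReal.ofReal (√D * ((ℓ : ℝ) ^ n)⁻¹) :=
  Metric.ediam_le_of_forall_dist_le fun _ hx _ hy => dist_le_of_mem_adicCube hx hy

theorem inv_pow_div_two_le_diam_adicCube (hD : 1 ≤ D) (hℓ : 0 < ℓ) (k : Fin D → Fin (ℓ ^ n)) :
    ((ℓ : ℝ) ^ n)⁻¹ / 2 ≤ Metric.diam (adicCube D ℓ n k) := by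
  have h_pos : (0 : ℝ) < (ℓ : ℝ) ^ n := by positivity
  set point : ℝ → EuclideanSpace ℝ (Fin D) := fun t =>
    WithLp.toLp 2 fun i => ((k i : ℕ) + t) / (ℓ : ℝ) ^ n
  have h_mem : ∀ t, 0 ≤ t → t < 1 → point t ∈ adicCube D ℓ n k := fun t ht ht' i =>
    ⟨div_le_div_of_nonneg_right (by linarith) h_pos.le,
      div_lt_div_of_pos_right (by linarith) h_pos⟩
  have h_bounded : Bornology.IsBounded (adicCube D ℓ n k) :=
    Metric.isBounded_iff.2 ⟨_, fun _ hx _ hy => dist_le_of_mem_adicCube hx hy⟩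
  calc ((ℓ : ℝ) ^ n)⁻¹ / 2 = dist (point (1 / 2) ⟨0, hD⟩) (point 0 ⟨0, hD⟩) := by
        rw [Real.dist_eq, abs_of_nonneg] <;> simp only [point, ← sub_div] <;> ring_nf
        positivity
    _ ≤ dist (point (1 / 2)) (point 0) := PiLp.dist_apply_le _ _ _
    _ ≤ Metric.diam (adicCube D ℓ n k) := Metric.dist_le_diam_of_mem h_bounded
        (h_mem _ (by norm_num) (by norm_num)) (h_mem _ le_rfl one_pos)

theorem abs_log_diam_adicCube_add_le (hD : 1 ≤ D) (hℓ : 0 < ℓ) (k : Fin D → Fin (ℓ ^ n)) :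
    |Real.log (Metric.diam (adicCube D ℓ n k)) + n * Real.log ℓ| ≤
      Real.log 2 + Real.log √D := by
  have hD_sqrt : (1 : ℝ) ≤ √D := Real.one_le_sqrt.2 (Nat.one_le_cast.2 hD)
  have h_lower := inv_pow_div_two_le_diam_adicCube hD hℓ k
  have h_upper := Metric.diam_le_of_forall_dist_le (by positivity) fun x hx y hy =>
    dist_le_of_mem_adicCube (k := k) (x := x) hx hy
  have h_log_lower := Real.log_le_log (by positivity) h_lower
  have h_log_upper := Real.log_le_log (lt_of_lt_of_le (by positivity) h_lower) h_upper
  rw [Real.log_div (by positivity) two_ne_zero, Real.log_inv, Real.log_pow] at h_log_lower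
  rw [Real.log_mul (by positivity) (by positivity), Real.log_inv, Real.log_pow] at h_log_upper
  have h_log_two : 0 ≤ Real.log 2 := Real.log_nonneg one_le_two
  have h_log_sqrt : 0 ≤ Real.log √D := Real.log_nonneg hD_sqrt
  rw [abs_le]
  constructor <;> linarith

end Cubes

/-! ### Neighbouring cubes -/

section Neighbours

variable {D ℓ n : ℕ}

/-- The indices of the cubes of generation `n` that touch the cube with index `k`, including `k`
itself. -/
def neighbours (k : Fin D → Fin (ℓ ^ n)) : Finset (Fin D → Fin (ℓ ^ n)) :=
  Fintype.piFinset fun i => {j | (j : ℕ) ≤ k i + 1 ∧ (k i : ℕ) ≤ j + 1}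

theorem mem_neighbours {k k' : Fin D → Fin (ℓ ^ n)} :
    k' ∈ neighbours k ↔ ∀ i, (k' i : ℕ) ≤ k i + 1 ∧ (k i : ℕ) ≤ k' i + 1 := by
  simp [neighbours]

theorem mem_neighbours_comm {k k' : Fin D → Fin (ℓ ^ n)} :
    k' ∈ neighbours k ↔ k ∈ neighbours k' := by
  simp only [mem_neighbours, and_comm]

theorem card_neighbours_le (k : Fin D → Fin (ℓ ^ n)) : (neighbours k).card ≤ 3 ^ D := by
  have h_card : ∀ i, Finset.card {j : Fin (ℓ ^ n) | (j : ℕ) ≤ k i + 1 ∧ (k i : ℕ) ≤ j + 1} ≤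
      3 := fun i => by
    have h_Icc : (Finset.Icc ((k i : ℕ) - 1) (k i + 1)).card ≤ 3 := by
      rw [Nat.card_Icc]
      omega
    refine (Finset.card_le_card_of_injOn Fin.val (fun j hj => ?_)
      Fin.val_injective.injOn).trans h_Icc
    rw [Finset.coe_filter_univ, Set.mem_ofPred_eq] at hj
    exact Finset.mem_coe.2 (Finset.mem_Icc.2 (by omega))
  rw [neighbours, Fintype.card_piFinset]
  simpa using Finset.prod_le_prod' fun i (_ : i ∈ Finset.univ) => h_card i

theorem sum_sum_neighbours_le {f : (Fin D → Fin (ℓ ^ n)) → ℝ} (hf : ∀ k, 0 ≤ f k) :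
    ∑ k, ∑ k' ∈ neighbours k, f k' ≤ 3 ^ D * ∑ k, f k := by
  rw [Finset.sum_comm' (t' := Finset.univ) (s' := neighbours)
    (by simp [mem_neighbours_comm]), Finset.mul_sum]
  refine Finset.sum_le_sum fun k _ => ?_
  rw [Finset.sum_const, nsmul_eq_mul]
  exact mul_le_mul_of_nonneg_right (mod_cast card_neighbours_le k) (hf k)

theorem closedBall_inter_unitCube_subset (hℓ : 0 < ℓ) {k : Fin D → Fin (ℓ ^ n)}
    {x : EuclideanSpace ℝ (Fin D)} (hx : x ∈ adicCube D ℓ n k) :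
    Metric.closedBall x ((ℓ : ℝ) ^ n)⁻¹ ∩ unitCube D ⊆
      ⋃ k' ∈ neighbours k, adicCube D ℓ n k' := by
  rintro y ⟨hy, hy_unit⟩
  have h_pos : (0 : ℝ) < (ℓ : ℝ) ^ n := by positivity
  obtain ⟨k', hk'⟩ := exists_mem_adicCube hℓ n hy_unit
  refine Set.mem_biUnion (Finset.mem_coe.2 (mem_neighbours.2 fun i => ?_)) hk'
  have h_dist := (PiLp.dist_apply_le y x i).trans hy
  rw [Real.dist_eq, ← one_div, le_div_iff₀ h_pos, ← abs_of_pos h_pos, ← abs_mul, abs_le] at h_dist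
  have hxi := hx i
  have hyi := hk' i
  rw [Set.mem_Ico, div_le_iff₀ h_pos, lt_div_iff₀ h_pos] at hxi hyi
  have h_le : ((k' i : ℕ) : ℝ) < (k i : ℕ) + 1 + 1 := by linarith
  have h_ge : ((k i : ℕ) : ℝ) < (k' i : ℕ) + 1 + 1 := by linarith
  norm_cast at h_le h_ge
  exact ⟨Nat.lt_succ_iff.1 h_le, Nat.lt_succ_iff.1 h_ge⟩

variable {m : Measure (EuclideanSpace ℝ (Fin D))} [IsFiniteMeasure m]

theorem measureReal_closedBall_le_sum_neighbours (hℓ : 0 < ℓ) (hm : ∀ᵐ x ∂m, x ∈ unitCube D)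
    {k : Fin D → Fin (ℓ ^ n)} {x : EuclideanSpace ℝ (Fin D)} (hx : x ∈ adicCube D ℓ n k) :
    m.real (Metric.closedBall x ((ℓ : ℝ) ^ n)⁻¹) ≤
      ∑ k' ∈ neighbours k, m.real (adicCube D ℓ n k') := by
  refine le_trans (ENNReal.toReal_mono (measure_ne_top _ _) (measure_mono_ae ?_))
    (measureReal_biUnion_finset_le _ _)
  filter_upwards [hm] with y hy_unit hy
  exact closedBall_inter_unitCube_subset hℓ hx ⟨hy, hy_unit⟩

theorem mul_measureReal_setOf_lt_closedBall_le (hℓ : 0 < ℓ) (hm : ∀ᵐ x ∂m, x ∈ unitCube D) (n : ℕ)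
    {c : ℝ} (hc : 0 ≤ c) :
    c * m.real {x | ∃ k, x ∈ adicCube D ℓ n k ∧
        c * m.real (adicCube D ℓ n k) < m.real (Metric.closedBall x ((ℓ : ℝ) ^ n)⁻¹)} ≤
      3 ^ D * m.real Set.univ := by
  classical
  set S : Finset (Fin D → Fin (ℓ ^ n)) := {k | c * m.real (adicCube D ℓ n k) <
    ∑ k' ∈ neighbours k, m.real (adicCube D ℓ n k')}
  calc _ ≤ c * m.real (⋃ k ∈ S, adicCube D ℓ n k) := by
        refine mul_le_mul_of_nonneg_left (measureReal_mono ?_ (measure_ne_top _ _)) hc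
        rintro x ⟨k, hxk, h_lt⟩
        refine Set.mem_biUnion (Finset.mem_coe.2 (Finset.mem_filter.2 ⟨Finset.mem_univ k, ?_⟩)) hxk
        exact h_lt.trans_le (measureReal_closedBall_le_sum_neighbours hℓ hm hxk)
    _ ≤ c * ∑ k ∈ S, m.real (adicCube D ℓ n k) :=
        mul_le_mul_of_nonneg_left (measureReal_biUnion_finset_le _ _) hc
    _ ≤ ∑ k ∈ S, ∑ k' ∈ neighbours k, m.real (adicCube D ℓ n k') := by
        rw [Finset.mul_sum]
        exact Finset.sum_le_sum fun k hk => (Finset.mem_filter.1 hk).2.le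
    _ ≤ ∑ k, ∑ k' ∈ neighbours k, m.real (adicCube D ℓ n k') :=
        Finset.sum_le_univ_sum_of_nonneg fun k => Finset.sum_nonneg fun _ _ => measureReal_nonneg
    _ ≤ 3 ^ D * ∑ k, m.real (adicCube D ℓ n k) :=
        sum_sum_neighbours_le fun k => measureReal_nonneg
    _ ≤ 3 ^ D * m.real Set.univ := by
        gcongr
        rw [← measureReal_iUnion_fintype (pairwise_disjoint_adicCube hℓ) measurableSet_adicCube]
        exact measureReal_mono (Set.subset_univ _)

theorem ae_eventually_measureReal_closedBall_le (hℓ : 0 < ℓ) (hm : ∀ᵐ x ∂m, x ∈ unitCube D) :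
    ∀ᵐ x ∂m, ∀ᶠ n : ℕ in atTop, ∀ k, x ∈ adicCube D ℓ n k →
      m.real (Metric.closedBall x ((ℓ : ℝ) ^ n)⁻¹) ≤ n ^ 2 * m.real (adicCube D ℓ n k) := by
  set S : ℕ → Set (EuclideanSpace ℝ (Fin D)) := fun n => {x | ∃ k, x ∈ adicCube D ℓ n k ∧
    n ^ 2 * m.real (adicCube D ℓ n k) < m.real (Metric.closedBall x ((ℓ : ℝ) ^ n)⁻¹)}
  have h_summable : Summable fun n => m.real (S n) := by
    refine summable_of_isBigO_nat (Real.summable_one_div_nat_pow.2 one_lt_two)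
      (Asymptotics.IsBigO.of_bound (3 ^ D * m.real Set.univ) ?_)
    filter_upwards [eventually_gt_atTop 0] with n hn
    rw [Real.norm_of_nonneg measureReal_nonneg, Real.norm_of_nonneg (by positivity), mul_one_div,
      le_div_iff₀' (by positivity)]
    exact mul_measureReal_setOf_lt_closedBall_le hℓ hm n (sq_nonneg _)
  have h_sum : ∑' n, m (S n) ≠ ⊤ := by
    simpa only [ofReal_measureReal (measure_ne_top m _)] using h_summable.tsum_ofReal_ne_top
  filter_upwards [ae_eventually_notMem h_sum] with x hx
  filter_upwards [hx] with n hn k hk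
  exact not_lt.1 fun h_lt => hn ⟨k, hk, h_lt⟩

end Neighbours

/-! ### Codings -/

section Coding

variable {D ℓ : ℕ} {I : List (Fin (ℓ ^ D)) → Set (EuclideanSpace ℝ (Fin D))}
  {m : Measure (EuclideanSpace ℝ (Fin D))}

theorem IsQuasiBernoulli.ae_mem_unitCube (hm : IsQuasiBernoulli I m) :
    ∀ᵐ x ∂m, x ∈ unitCube D :=
  have := hm.isProbabilityMeasure
  mem_ae_iff.2 ((prob_compl_eq_zero_iff measurableSet_unitCube).2 hm.measure_unitCube)

namespace IsCoding

theorem exists_eq_adicCube (hI : IsCoding D ℓ I) (w : List (Fin (ℓ ^ D))) :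
    ∃ k, I w = adicCube D ℓ w.length k := by
  obtain ⟨k, hk⟩ := (hI.bijOn w.length).mapsTo (rfl : w.length = w.length)
  exact ⟨k, hk.symm⟩

theorem append_subset (hI : IsCoding D ℓ I) (u v : List (Fin (ℓ ^ D))) : I (u ++ v) ⊆ I u := by
  induction v using List.reverseRecOn with
  | nil => rw [List.append_nil]
  | append_singleton v e ih =>
    rw [← List.append_assoc]
    exact (hI.nested (u ++ v) e).trans ih

theorem isNestedPartition (hI : IsCoding D ℓ I) (hℓ : 0 < ℓ) (hm : ∀ᵐ x ∂m, x ∈ unitCube D) :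
    IsNestedPartition m I where
  measurableSet w := by
    obtain ⟨k, hk⟩ := hI.exists_eq_adicCube w
    exact hk ▸ measurableSet_adicCube k
  append_subset := hI.append_subset
  disjoint u v h_len h_ne := by
    obtain ⟨k, hk⟩ := (hI.bijOn v.length).mapsTo h_len
    obtain ⟨k', hk'⟩ := (hI.bijOn v.length).mapsTo (rfl : v.length = v.length)
    have h_image : I u ≠ I v := (hI.bijOn v.length).injOn.ne h_len rfl h_ne
    rw [← hk, ← hk'] at h_image ⊢
    exact pairwise_disjoint_adicCube hℓ fun h_eq => h_image (congrArg _ h_eq)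
  ae_exists_mem n := by
    filter_upwards [hm] with x hx
    obtain ⟨k, hk⟩ := exists_mem_adicCube hℓ n hx
    obtain ⟨w, hw_len, hw⟩ := (hI.bijOn n).surjOn ⟨k, rfl⟩
    exact ⟨w, hw_len, hw ▸ hk⟩

theorem sum_adicCube_eq {M : Type*} [AddCommMonoid M] (hI : IsCoding D ℓ I) (hℓ : 0 < ℓ) (n : ℕ)
    (f : Set (EuclideanSpace ℝ (Fin D)) → M) :
    ∑ k, f (adicCube D ℓ n k) = ∑ w ∈ words (Fin (ℓ ^ D)) n, f (I w) := by
  have h_words : (words (Fin (ℓ ^ D)) n : Set (List (Fin (ℓ ^ D)))) = {w | w.length = n} := by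
    ext w
    simp
  rw [← finsum_eq_sum_of_fintype, ← finsum_mem_coe_finset, h_words,
    ← finsum_mem_range (adicCube_injective hℓ)]
  exact (finsum_mem_eq_of_bijOn I (hI.bijOn n) fun _ _ => rfl).symm

theorem tauAt_eq (hI : IsCoding D ℓ I) (hℓ : 0 < ℓ) (n : ℕ) (q : ℝ) :
    tauAt ℓ m n q =
      Real.log (partitionSum (fun w => m.real (I w)) n q) / n / Real.log ℓ := by
  rw [tauAt, partitionSum, positiveWords, Finset.sum_filter, Finset.sum_filter,
    hI.sum_adicCube_eq hℓ n fun U => if 0 < m.real U then m.real U ^ q else 0,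
    div_div, one_div, inv_mul_eq_div]

theorem exists_isQuasiMultiplicative (hI : IsCoding D ℓ I) (hℓ : 0 < ℓ)
    (hm : IsQuasiBernoulli I m) : ∃ C, IsQuasiMultiplicative (fun w => m.real (I w)) C := by
  have := hm.isProbabilityMeasure
  obtain ⟨C, hC, h_quasi⟩ := hm.quasi
  exact ⟨C, hC, fun _ => measureReal_nonneg,
    fun n => ((hI.isNestedPartition hℓ hm.ae_mem_unitCube).sum_measureReal n).trans
      probReal_univ, fun u v => (h_quasi u v).1, fun u v => (h_quasi u v).2⟩

theorem tau_eq (hI : IsCoding D ℓ I) (hℓ : 0 < ℓ) (hm : IsQuasiBernoulli I m) (q : ℝ) :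
    tau ℓ m q = pressure (fun w => m.real (I w)) q / Real.log ℓ := by
  obtain ⟨C, hC⟩ := hI.exists_isQuasiMultiplicative hℓ hm
  simp only [tau, hI.tauAt_eq hℓ]
  exact ((hC.tendsto_pressure q).div_const _).limsup_eq

theorem hasQuadraticExpansion_pressure (hI : IsCoding D ℓ I) (hℓ : 2 ≤ ℓ)
    (hm : IsQuasiBernoulli I m) {d v : ℝ} (hτ : HasQuadraticExpansion (tau ℓ m) d v) :
    HasQuadraticExpansion (pressure fun w => m.real (I w)) (Real.log ℓ * d) (Real.log ℓ * v) := by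
  have h_log : Real.log ℓ ≠ 0 := (Real.log_pos (Nat.one_lt_cast.2 hℓ)).ne'
  have h_tau : (fun q => Real.log ℓ * tau ℓ m q) = pressure fun w => m.real (I w) := by
    funext q
    rw [hI.tau_eq (by omega) hm, mul_div_cancel₀ _ h_log]
  exact h_tau ▸ hτ.const_mul (Real.log ℓ)

theorem ae_forall_exists_mem_deviatingWords (hI : IsCoding D ℓ I) (hℓ : 2 ≤ ℓ)
    (hm : IsQuasiBernoulli I m) {d v : ℝ} (hv : 0 < v) (hτ : HasQuadraticExpansion (tau ℓ m) d v)
    {s : ℝ} (hs : |s| = 1) (A : ℝ) :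
    ∀ᵐ x ∂m, ∀ N, ∃ w ∈ deviatingWords (fun w => m.real (I w)) (Real.log ℓ * d) s A,
      N ≤ w.length ∧ x ∈ I w := by
  have := hm.isProbabilityMeasure
  have hℓ_pos : 0 < ℓ := by omega
  obtain ⟨C, hC⟩ := hI.exists_isQuasiMultiplicative hℓ_pos hm
  exact (hI.isNestedPartition hℓ_pos hm.ae_mem_unitCube).ae_forall_exists_mem_deviatingWords hC
    (mul_pos (Real.log_pos (Nat.one_lt_cast.2 hℓ)) hv)
    (hI.hasQuadraticExpansion_pressure hℓ hm hτ) hs A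

end IsCoding

end Coding

/-! ### The gauge -/

section Gauge

variable {ℓ : ℕ} {t : ℝ}

theorem psi_pos (hℓ : 0 < ℓ) (ht : 0 < t) (d a : ℝ) : 0 < psi ℓ d a t :=
  mul_pos (Real.rpow_pos_of_pos ht d) (Real.rpow_pos_of_pos (Nat.cast_pos.2 hℓ) _)

theorem log_psi (hℓ : 0 < ℓ) (ht : 0 < t) (d a : ℝ) :
    Real.log (psi ℓ d a t) = d * Real.log t + a * √(Real.logb ℓ (1 / t)) * Real.log ℓ := by
  have hℓ_pos : (0 : ℝ) < ℓ := Nat.cast_pos.2 hℓ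
  rw [psi, Real.log_mul (by positivity) (by positivity), Real.log_rpow ht, Real.log_rpow hℓ_pos]

theorem sqrt_logb_one_div_le (hℓ : 2 ≤ ℓ) {n : ℕ} {K : ℝ}
    (hK : |Real.log t + n * Real.log ℓ| ≤ K) :
    √(Real.logb ℓ (1 / t)) ≤ √n + √(K / Real.log ℓ) := by
  have h_log : 0 < Real.log ℓ := Real.log_pos (Nat.one_lt_cast.2 hℓ)
  have hK_nonneg : 0 ≤ K := (abs_nonneg _).trans hK
  refine (Real.sqrt_le_sqrt ?_).trans
    (sqrt_add_le_add_sqrt (Nat.cast_nonneg n) (div_nonneg hK_nonneg h_log.le))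
  rw [one_div, Real.logb_inv, Real.logb, ← neg_div, div_le_iff₀ h_log, add_mul,
    div_mul_cancel₀ _ h_log.ne']
  linarith [(abs_le.1 hK).1]

theorem exists_abs_log_psi_add_le (hℓ : 2 ≤ ℓ) (d a K : ℝ) :
    ∃ M, ∀ t > 0, ∀ n : ℕ, |Real.log t + n * Real.log ℓ| ≤ K →
      |Real.log (psi ℓ d a t) + n * (Real.log ℓ * d)| ≤ Real.log ℓ * |a| * √n + M := by
  have h_log : 0 < Real.log ℓ := Real.log_pos (Nat.one_lt_cast.2 hℓ)
  refine ⟨|d| * K + Real.log ℓ * |a| * √(K / Real.log ℓ), fun t ht n hK => ?_⟩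
  calc |Real.log (psi ℓ d a t) + n * (Real.log ℓ * d)|
      = |d * (Real.log t + n * Real.log ℓ) + a * √(Real.logb ℓ (1 / t)) * Real.log ℓ| := by
        rw [log_psi (by omega) ht]
        ring_nf
    _ ≤ |d| * |Real.log t + n * Real.log ℓ| +
          Real.log ℓ * |a| * √(Real.logb ℓ (1 / t)) := by
        refine (abs_add_le _ _).trans_eq ?_
        rw [abs_mul, abs_mul, abs_mul, abs_of_pos h_log, abs_of_nonneg (Real.sqrt_nonneg _)]
        ring
    _ ≤ |d| * K + Real.log ℓ * |a| * (√n + √(K / Real.log ℓ)) := by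
        gcongr
        exact sqrt_logb_one_div_le hℓ hK
    _ = _ := by ring

end Gauge

theorem eventually_sq_mul_exp_neg_sqrt_le_one :
    ∀ᶠ n : ℕ in atTop, (n : ℝ) ^ 2 * Real.exp (-√n) ≤ 1 := by
  have h_lim := (Real.tendsto_pow_mul_exp_neg_atTop_nhds_zero 4).comp tendsto_sqrt_natCast_atTop
  filter_upwards [h_lim.eventually_le_const one_pos] with n hn
  rwa [Function.comp_apply, pow_mul _ 2 2, Real.sq_sqrt (Nat.cast_nonneg n)] at hn

theorem summable_exp_neg_sqrt : Summable fun n : ℕ => Real.exp (-√(n : ℝ)) := by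
  refine summable_of_isBigO_nat (Real.summable_one_div_nat_pow.2 one_lt_two)
    (Asymptotics.IsBigO.of_bound 1 ?_)
  filter_upwards [eventually_sq_mul_exp_neg_sqrt_le_one, eventually_gt_atTop 0] with n hn hn_pos
  rwa [one_mul, Real.norm_of_nonneg (Real.exp_pos _).le, Real.norm_of_nonneg (by positivity),
    le_div_iff₀' (by positivity)]

/-! ### Heavy cubes and the Hausdorff measure -/

theorem IsQuasiMultiplicative.tsum_ofReal_mul_ne_top {α : Type*} [Finite α] {μ : List α → ℝ}
    {C : ℝ} (h : IsQuasiMultiplicative μ C) {c : ℕ → ℝ} (hc : ∀ n, 0 ≤ c n)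
    (hc_summable : Summable c) : ∑' w, ENNReal.ofReal (c w.length * μ w) ≠ ⊤ := by
  have h_sum : ∀ n, ∑ w ∈ words α n, ENNReal.ofReal (c w.length * μ w) = ENNReal.ofReal (c n) := by
    intro n
    rw [← ENNReal.ofReal_sum_of_nonneg fun w _ => mul_nonneg (hc _) (h.nonneg w)]
    congr 1
    calc ∑ w ∈ words α n, c w.length * μ w = ∑ w ∈ words α n, c n * μ w :=
          Finset.sum_congr rfl fun w hw => by rw [mem_words.1 hw]
      _ = c n := by rw [← Finset.mul_sum, h.sum_eq_one, mul_one]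
  simp only [tsum_eq_tsum_sum_words, h_sum]
  exact hc_summable.tsum_ofReal_ne_top

theorem tendsto_length_cofinite (α : Type*) [Finite α] :
    Tendsto (List.length : List α → ℕ) cofinite atTop := by
  rw [← Nat.cofinite_eq_atTop]
  exact .cofinite_of_finite_preimage_singleton fun n => List.finite_length_eq α n

namespace IsCoding

variable {D ℓ : ℕ} {I : List (Fin (ℓ ^ D)) → Set (EuclideanSpace ℝ (Fin D))}
  {m : Measure (EuclideanSpace ℝ (Fin D))}

theorem tendsto_ediam_cofinite (hI : IsCoding D ℓ I) (hℓ : 2 ≤ ℓ) :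
    Tendsto (fun w => Metric.ediam (I w)) cofinite (𝓝 0) := by
  have h_real : Tendsto (fun n : ℕ => √D * ((ℓ : ℝ) ^ n)⁻¹) atTop (𝓝 0) := by
    simpa using (tendsto_pow_atTop_atTop_of_one_lt
      (Nat.one_lt_cast (α := ℝ).2 hℓ)).inv_tendsto_atTop.const_mul √D
  have h_bound := (ENNReal.tendsto_ofReal h_real).comp (tendsto_length_cofinite (Fin (ℓ ^ D)))
  rw [ENNReal.ofReal_zero] at h_bound
  refine tendsto_of_tendsto_of_tendsto_of_le_of_le tendsto_const_nhds h_bound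
    (fun _ => bot_le) fun w => ?_
  obtain ⟨k, hk⟩ := hI.exists_eq_adicCube w
  exact hk ▸ ediam_adicCube_le k

theorem exists_psi_diam_le (hI : IsCoding D ℓ I) (hD : 1 ≤ D) (hℓ : 2 ≤ ℓ) (d a : ℝ) :
    ∃ M, ∀ w ∈ deviatingWords (fun w => m.real (I w)) (Real.log ℓ * d) 1 (Real.log ℓ * |a| + 1),
      psi ℓ d a (Metric.diam (I w)) ≤ Real.exp M * Real.exp (-√w.length) * m.real (I w) := by
  obtain ⟨M, hM⟩ := exists_abs_log_psi_add_le hℓ d a (Real.log 2 + Real.log √D)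
  refine ⟨M, fun w ⟨h_pos, h_dev⟩ => ?_⟩
  obtain ⟨k, hk⟩ := hI.exists_eq_adicCube w
  have hℓ_pos : 0 < ℓ := by omega
  have h_diam : 0 < Metric.diam (I w) :=
    hk ▸ lt_of_lt_of_le (by positivity) (inv_pow_div_two_le_diam_adicCube hD hℓ_pos k)
  have h_psi := hM _ h_diam w.length (hk ▸ abs_log_diam_adicCube_add_le hD hℓ_pos k)
  rw [one_mul, deviation] at h_dev
  rw [← Real.exp_add, ← Real.log_le_log_iff (psi_pos hℓ_pos h_diam d a) (by positivity),
    Real.log_mul (Real.exp_ne_zero _) h_pos.ne', Real.log_exp]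
  linarith [(abs_le.1 h_psi).2]

theorem mutuallySingular_hausdorffGauge (hI : IsCoding D ℓ I) (hD : 1 ≤ D) (hℓ : 2 ≤ ℓ)
    (hm : IsQuasiBernoulli I m) {d v : ℝ} (hv : 0 < v) (hτ : HasQuadraticExpansion (tau ℓ m) d v)
    (a : ℝ) : m ⟂ₘ hausdorffGauge (psi ℓ d a) := by
  obtain ⟨C, hC⟩ := hI.exists_isQuasiMultiplicative (by omega) hm
  set S := deviatingWords (fun w => m.real (I w)) (Real.log ℓ * d) 1 (Real.log ℓ * |a| + 1)
  obtain ⟨M, hM⟩ := hI.exists_psi_diam_le (m := m) hD hℓ d a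
  have h_sum : ∑' w : S, ENNReal.ofReal (psi ℓ d a (Metric.diam (I w))) ≠ ⊤ := by
    refine ne_top_of_le_ne_top (hC.tsum_ofReal_mul_ne_top (fun _ => by positivity)
      (summable_exp_neg_sqrt.mul_left (Real.exp M))) ?_
    refine le_trans ?_
      (ENNReal.tsum_comp_le_tsum_of_injective (Subtype.val_injective (p := (· ∈ S))) _)
    exact ENNReal.tsum_le_tsum fun w => ENNReal.ofReal_le_ofReal (hM w w.2)
  have h_null : hausdorffGauge (psi ℓ d a) {x | ∃ᶠ w : S in cofinite, x ∈ I w} = 0 :=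
    hausdorffGauge_setOf_frequently_mem_eq_zero
      ((hI.tendsto_ediam_cofinite hℓ).comp Subtype.val_injective.tendsto_cofinite) h_sum
  have h_ae : ∀ᵐ x ∂m, ∃ᶠ w : S in cofinite, x ∈ I w := by
    filter_upwards [hI.ae_forall_exists_mem_deviatingWords hℓ hm hv hτ abs_one
      (Real.log ℓ * |a| + 1)] with x hx
    refine frequently_cofinite_iff_infinite.2 (.of_image (fun w : S => w.1.length)
      (Set.infinite_of_forall_exists_gt fun N => ?_))
    obtain ⟨w, hwS, hN, hxw⟩ := hx (N + 1)
    exact ⟨w.length, ⟨⟨w, hwS⟩, hxw, rfl⟩, hN⟩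
  exact .mk (mem_ae_iff.1 h_ae) h_null (by simp)

end IsCoding

/-! ### Light cubes and the packing measure -/

theorem eventually_sq_mul_le_mul_psi {ℓ : ℕ} (hℓ : 2 ≤ ℓ) (d a : ℝ) {ε : ℝ} (hε : 0 < ε) :
    ∀ᶠ n : ℕ in atTop, ∀ p > 0,
      (Real.log ℓ * |a| + 2) * √n ≤ -(Real.log p + n * (Real.log ℓ * d)) →
        n ^ 2 * p ≤ ε * psi ℓ d a (2 * (((ℓ : ℝ) ^ n)⁻¹ / 5)) := by
  have hℓ_pos : 0 < ℓ := by omega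
  obtain ⟨M, hM⟩ := exists_abs_log_psi_add_le hℓ d a |Real.log (2 / 5)|
  filter_upwards [eventually_sq_mul_exp_neg_sqrt_le_one,
    tendsto_sqrt_natCast_atTop.eventually_ge_atTop (M - Real.log ε)] with n h_sq h_large p hp h_dev
  have hr : 0 < 2 * (((ℓ : ℝ) ^ n)⁻¹ / 5) := by positivity
  have h_psi := hM _ hr n (by
    rw [← mul_comm_div, Real.log_mul (by norm_num) (by positivity), Real.log_inv, Real.log_pow,
      neg_add_cancel_right])
  rw [Real.exp_neg, ← div_eq_mul_inv, div_le_one (Real.exp_pos _)] at h_sq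
  have h_psi_pos := psi_pos hℓ_pos hr d a
  refine (mul_le_mul_of_nonneg_right h_sq hp.le).trans ?_
  rw [← Real.log_le_log_iff (by positivity) (by positivity),
    Real.log_mul (Real.exp_ne_zero _) hp.ne', Real.log_exp, Real.log_mul hε.ne' h_psi_pos.ne']
  linarith [(abs_le.1 h_psi).1]

namespace IsCoding

variable {D ℓ : ℕ} {I : List (Fin (ℓ ^ D)) → Set (EuclideanSpace ℝ (Fin D))}
  {m : Measure (EuclideanSpace ℝ (Fin D))}

theorem ae_hasVanishingLowerDensity (hI : IsCoding D ℓ I) (hℓ : 2 ≤ ℓ)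
    (hm : IsQuasiBernoulli I m) {d v : ℝ} (hv : 0 < v) (hτ : HasQuadraticExpansion (tau ℓ m) d v)
    (a : ℝ) : ∀ᵐ x ∂m, HasVanishingLowerDensity m (psi ℓ d a) x := by
  have := hm.isProbabilityMeasure
  have hℓ_pos : 0 < ℓ := by omega
  have h_radius : Tendsto (fun n : ℕ => ((ℓ : ℝ) ^ n)⁻¹ / 5) atTop (𝓝[>] 0) := by
    refine tendsto_nhdsWithin_iff.2 ⟨?_, Eventually.of_forall fun n => ?_⟩
    · simpa using (tendsto_pow_atTop_atTop_of_one_lt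
        (Nat.one_lt_cast (α := ℝ).2 hℓ)).inv_tendsto_atTop.div_const 5
    · exact Set.mem_Ioi.2 (by positivity)
  filter_upwards [ae_eventually_measureReal_closedBall_le hℓ_pos hm.ae_mem_unitCube,
    hI.ae_forall_exists_mem_deviatingWords hℓ hm hv hτ (s := -1) (by norm_num)
      (Real.log ℓ * |a| + 2)]
    with x h_ball h_word ε hε
  have h_light : ∃ᶠ n in atTop, ∃ w ∈ deviatingWords (fun w => m.real (I w)) (Real.log ℓ * d) (-1)
      (Real.log ℓ * |a| + 2), w.length = n ∧ x ∈ I w := by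
    refine frequently_atTop.2 fun N => ?_
    obtain ⟨w, hw, hN, hxw⟩ := h_word N
    exact ⟨w.length, hN, w, hw, rfl, hxw⟩
  refine h_radius.frequently ((h_light.and_eventually
    (h_ball.and (eventually_sq_mul_le_mul_psi hℓ d a hε))).mono ?_)
  rintro _ ⟨⟨w, ⟨h_pos, h_dev⟩, rfl, hxw⟩, h_ball, h_psi⟩
  obtain ⟨k, hk⟩ := hI.exists_eq_adicCube w
  rw [neg_one_mul, deviation] at h_dev
  rw [mul_div_cancel₀ _ (by norm_num : (5 : ℝ) ≠ 0)]
  refine (h_ball k (hk ▸ hxw)).trans ?_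
  rw [← hk]
  exact h_psi _ h_pos h_dev

end IsCoding

end QuasiBernoulli

end

theorem mainTheorem8_general (D ℓ : ℕ) (hD : 1 ≤ D) (hℓ : 2 ≤ ℓ)
    (I : List (Fin (ℓ ^ D)) → Set (EuclideanSpace ℝ (Fin D)))
    (hI : QuasiBernoulli.IsCoding D ℓ I)
    (m : Measure (EuclideanSpace ℝ (Fin D)))
    (hm : QuasiBernoulli.IsQuasiBernoulli I m)
    (d : ℝ) (hd : d = -deriv (QuasiBernoulli.tau ℓ m) 1)
    (σ : ℝ) (hσ : 0 < σ)
    (hτ : (fun q : ℝ => QuasiBernoulli.tau ℓ m (1 - q) - (q * d + σ ^ 2 / 2 * q ^ 2))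
      =o[𝓝 0] fun q : ℝ => q ^ 2) (a : ℝ) :
    m ⟂ₘ QuasiBernoulli.hausdorffGauge (QuasiBernoulli.psi ℓ d a) ∧
      m ≪ QuasiBernoulli.packingGauge (QuasiBernoulli.psi ℓ d a) := by
  have := hm.isProbabilityMeasure
  have h_expansion : QuasiBernoulli.HasQuadraticExpansion (QuasiBernoulli.tau ℓ m) d (σ ^ 2) := hτ
  exact ⟨hI.mutuallySingular_hausdorffGauge hD hℓ hm (pow_pos hσ 2) h_expansion a,
    QuasiBernoulli.absolutelyContinuous_packingGauge
      (hI.ae_hasVanishingLowerDensity hℓ hm (pow_pos hσ 2) h_expansion a)⟩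

theorem mainTheorem8 (D ℓ : ℕ) (hD : 1 ≤ D) (hℓ : 2 ≤ ℓ)
    (I : List (Fin (ℓ ^ D)) → Set (EuclideanSpace ℝ (Fin D)))
    (hI : QuasiBernoulli.IsCoding D ℓ I)
    (m : Measure (EuclideanSpace ℝ (Fin D)))
    (hm : QuasiBernoulli.IsQuasiBernoulli I m)
    (d : ℝ) (hd : d = -deriv (QuasiBernoulli.tau ℓ m) 1)
    (σ : ℝ) (hσ : 0 < σ)
    (hτ : (fun q : ℝ => QuasiBernoulli.tau ℓ m (1 - q) - (q * d + σ ^ 2 / 2 * q ^ 2))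
      =o[𝓝 0] fun q : ℝ => q ^ 2) :
    (∀ a : ℝ, 0 < a → m ⟂ₘ QuasiBernoulli.hausdorffGauge (QuasiBernoulli.psi ℓ d a)) ∧
      ∀ a : ℝ, a < 0 → m ≪ QuasiBernoulli.packingGauge (QuasiBernoulli.psi ℓ d a) :=
  have h_general := mainTheorem8_general D ℓ hD hℓ I hI m hm d hd σ hσ hτ
  ⟨fun a _ => (h_general a).1, fun a _ => (h_general a).2⟩
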